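/- Let $\mathcal G$ be the planar Galilean conformal algebra: the complex Lie algebra with basis $\{L_m,H_m,I_m,J_m : m\in\mathbb Z\}$ and nontrivial brackets $$[L_n,L_m]=(m-n)L_{m+n},\quad [L_n,H_m]=mH_{m+n},\quad [L_n,I_m]=(m-n)I_{m+n},\quad [L_n,J_m]=(m-n)J_{m+n},$$ $$[H_n,I_m]=I_{m+n},\quad [H_n,J_m]=-J_{m+n}.$$ Let $\widetilde{\mathcal G}$ be its universal central extension, with basis $\{L_m,H_m,I_m,J_m,C_1,C_2,C_3\}$, where $C_1,C_2,C_3$ are central and the brackets are as above except that $$[L_n,L_m]=(m-n)L_{m+n}+n^3\delta_{m+n,0}C_1,\quad [L_n,H_m]=mH_{m+n}+n^2\delta_{m+n,0}C_2,\quad [H_n,H_m]=n\delta_{m+n,0}C_3.$$ Let $\mathcal G^+=\widetilde{\mathcal G}^+$ be the span of all $L_m,H_m,I_m,J_m$ with $m\ge 1$, and let $\mathcal I$ and $\mathcal J$ be the ideals spanned by all $I_m$ and by all $J_m$ ($m\in\mathbb Z$), respectively. For a Lie algebra homomorphism $\phi:\mathcal G^+\to\mathbb C$ let $\mathbb C_\phi$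 be the one-dimensional module on which $x\in\mathcal G^+$ acts as $\phi(x)$, and for $\xi=(\xi_1,\xi_2,\xi_3)\in\mathbb C^3$ put $$L_\phi=U(\mathcal G)\otimes_{U(\mathcal G^+)}\mathbb C_\phi,\qquad \widetilde M(\phi)=U(\widetilde{\mathcal G})\otimes_{U(\widetilde{\mathcal G}^+)}\mathbb C_\phi,\qquad \widetilde L_{\phi,\xi}=\widetilde M(\phi)\Big/\sum_{s=1}^3(C_s-\xi_s)\widetilde M(\phi).$$ Theorem. Suppose that $\phi$ is singular, i.e. $\phi(I_1)\phi(J_1)=0$, and let $\xi\in\mathbb C^3$. Then the $\mathcal G$-module $L_\phi$ and the $\widetilde{\mathcal G}$-module $\widetilde L_{\phi,\xi}$ are reducible, i.e. each has a submodule other than $0$ and the whole module. More precisely: (i) If $\phi(I_1)=\phi(J_1)=0$, then $U(\mathcal G)(\mathcal I\oplus\mathcal J)L_\phi$ is a nonzero proper submodule of $L_\phi$, and for every $c\in\mathbb C$ the subspace $U(\widetilde{\mathcal G})(\mathcal I\oplus\mathcal J)\widetilde L_{\phi,\xi}+(H_0-c)\widetilde L_{\phi,\xi}$ is a nonzero proper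 submodule of $\widetilde L_{\phi,\xi}$. (ii) If $\phi(I_1)=0$ and $\phi(J_1)\neq0$, then $U(\mathcal G)\,\mathcal I L_\phi$ and $U(\widetilde{\mathcal G})\,\mathcal I\widetilde L_{\phi,\xi}$ are nonzero proper submodules of $L_\phi$ and $\widetilde L_{\phi,\xi}$, respectively. (iii) If $\phi(I_1)\neq0$ and $\phi(J_1)=0$, then $U(\mathcal G)\,\mathcal J L_\phi$ and $U(\widetilde{\mathcal G})\,\mathcal J\widetilde L_{\phi,\xi}$ are nonzero proper submodules of $L_\phi$ and $\widetilde L_{\phi,\xi}$, respectively. -/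

import Mathlib

noncomputable section

set_option linter.unusedSimpArgs false
set_option linter.unusedTactic false

attribute [local instance] LieRing.ofAssociativeRing

/-! ### Lie algebras given by structure constants on a basis -/

/-- The bilinear extension of a product given on the basis vectors of `ι →₀ ℂ`. -/
def bilinearExtension {ι : Type} (b : ι → ι → (ι →₀ ℂ)) :
    (ι →₀ ℂ) →ₗ[ℂ] (ι →₀ ℂ) →ₗ[ℂ] (ι →₀ ℂ) :=
  Finsupp.linearCombination ℂ (fun i => Finsupp.linearCombination ℂ (b i))

theorem bilinearExtension_single {ι : Type} (b : ι → ι → (ι →₀ ℂ)) (i j : ι) (r s : ℂ) :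
    bilinearExtension b (Finsupp.single i r) (Finsupp.single j s) = r • s • b i j := by
  simp [bilinearExtension]

theorem bilinearExtension_self {ι : Type} (b : ι → ι → (ι →₀ ℂ))
    (hskew : ∀ i j, b i j = - b j i) (x : ι →₀ ℂ) : bilinearExtension b x x = 0 := by
  have h : ∀ x y, bilinearExtension b x y = - bilinearExtension b y x := by
    intro x y
    induction x using Finsupp.induction_linear with
    | zero => simp
    | add x x' hx hx' => simp only [map_add, LinearMap.add_apply, hx, hx']; abel
    | single i r =>
      induction y using Finsupp.induction_linear with
      | zero => simp
      | add y y' hy hy' => simp only [map_add, LinearMap.add_apply, hy, hy']; abel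
      | single j s =>
        rw [bilinearExtension_single, bilinearExtension_single, hskew i j, smul_neg, smul_neg,
          smul_comm]
  exact self_eq_neg.mp (h x x)

theorem bilinearExtension_leibniz {ι : Type} (b : ι → ι → (ι →₀ ℂ))
    (hjac : ∀ i j k, bilinearExtension b (Finsupp.single i 1) (b j k) =
      bilinearExtension b (b i j) (Finsupp.single k 1) +
        bilinearExtension b (Finsupp.single j 1) (b i k)) (x y z : ι →₀ ℂ) :
    bilinearExtension b x (bilinearExtension b y z) =
      bilinearExtension b (bilinearExtension b x y) z +
        bilinearExtension b y (bilinearExtension b x z) := by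
  induction x using Finsupp.induction_linear with
  | zero => simp
  | add x x' hx hx' => simp only [map_add, LinearMap.add_apply, hx, hx']; abel
  | single i r =>
    induction y using Finsupp.induction_linear with
    | zero => simp
    | add y y' hy hy' => simp only [map_add, LinearMap.add_apply, hy, hy']; abel
    | single j s =>
      induction z using Finsupp.induction_linear with
      | zero => simp
      | add z z' hz hz' => simp only [map_add, hz, hz']; abel
      | single k t =>
        have h1 : ∀ (i : ι) (r : ℂ), Finsupp.single i r = r • Finsupp.single i (1 : ℂ) := by
          intro i r; simp
        rw [h1 i r, h1 j s, h1 k t]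
        simp only [map_smul, LinearMap.smul_apply, bilinearExtension_single, one_smul, hjac i j k,
          smul_add]
        simp only [smul_smul]
        congr 2
        ring

/-! ### The planar Galilean conformal algebra -/

/-- Labels of the basis of the planar Galilean conformal algebra. -/
inductive PGCAGen : Type
  | L (m : ℤ)
  | H (m : ℤ)
  | I (m : ℤ)
  | J (m : ℤ)

/-- The brackets of basis vectors of the planar Galilean conformal algebra. -/
def PGCAGen.bracket : PGCAGen → PGCAGen → (PGCAGen →₀ ℂ)
  | .L n, .L m => Finsupp.single (.L (m + n)) ((m : ℂ) - n)
  | .L n, .H m => Finsupp.single (.H (m + n)) (m : ℂ)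
  | .L n, .I m => Finsupp.single (.I (m + n)) ((m : ℂ) - n)
  | .L n, .J m => Finsupp.single (.J (m + n)) ((m : ℂ) - n)
  | .H n, .I m => Finsupp.single (.I (m + n)) 1
  | .H n, .J m => Finsupp.single (.J (m + n)) (-1)
  | .H m, .L n => - Finsupp.single (.H (m + n)) (m : ℂ)
  | .I m, .L n => - Finsupp.single (.I (m + n)) ((m : ℂ) - n)
  | .J m, .L n => - Finsupp.single (.J (m + n)) ((m : ℂ) - n)
  | .I m, .H n => - Finsupp.single (.I (m + n)) 1
  | .J m, .H n => - Finsupp.single (.J (m + n)) (-1)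
  | .H _, .H _ => 0
  | .I _, .I _ => 0
  | .I _, .J _ => 0
  | .J _, .I _ => 0
  | .J _, .J _ => 0

/-- The planar Galilean conformal algebra `𝒢`, with basis `L_m, H_m, I_m, J_m` for `m : ℤ`. -/
def PGCA : Type := PGCAGen →₀ ℂ

instance : AddCommGroup PGCA := inferInstanceAs (AddCommGroup (PGCAGen →₀ ℂ))
instance : Module ℂ PGCA := inferInstanceAs (Module ℂ (PGCAGen →₀ ℂ))

theorem PGCAGen.bracket_skew (i j : PGCAGen) : i.bracket j = - j.bracket i := by
  cases i <;> cases j <;> simp only [PGCAGen.bracket, neg_neg, neg_zero]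
  rename_i n m
  rw [add_comm n m, ← Finsupp.single_neg, neg_sub]

theorem PGCAGen.bracket_jacobi (i j k : PGCAGen) :
    bilinearExtension PGCAGen.bracket (Finsupp.single i 1) (j.bracket k) =
      bilinearExtension PGCAGen.bracket (i.bracket j) (Finsupp.single k 1) +
        bilinearExtension PGCAGen.bracket (Finsupp.single j 1) (i.bracket k) := by
  cases i <;> cases j <;> cases k <;> rename_i a b c <;>
    simp only [PGCAGen.bracket, bilinearExtension_single, map_neg, map_zero, LinearMap.neg_apply,
      LinearMap.zero_apply, smul_neg, smul_zero, neg_neg, neg_zero, add_zero, zero_add,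
      add_assoc, add_comm, add_left_comm, Finsupp.smul_single, ← Finsupp.single_neg,
      ← Finsupp.single_add, smul_eq_mul]
  all_goals first | done | (simp; done) | (congr 1; push_cast; ring)

instance : LieRing PGCA where
  bracket x y := bilinearExtension PGCAGen.bracket x y
  add_lie x y z := LinearMap.map_add₂ (bilinearExtension PGCAGen.bracket) x y z
  lie_add x y z := map_add (bilinearExtension PGCAGen.bracket x) y z
  lie_self := bilinearExtension_self _ PGCAGen.bracket_skew
  leibniz_lie := bilinearExtension_leibniz _ PGCAGen.bracket_jacobi

instance : LieAlgebra ℂ PGCA where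
  lie_smul t x y := map_smul (bilinearExtension PGCAGen.bracket x) t y

namespace PGCA

/-- The basis vector of `𝒢` with label `g`. -/
def e (g : PGCAGen) : PGCA := Finsupp.single g (1 : ℂ)

/-- The basis vector `L_m`. -/
abbrev L (m : ℤ) : PGCA := e (.L m)
/-- The basis vector `H_m`. -/
abbrev H (m : ℤ) : PGCA := e (.H m)
/-- The basis vector `I_m`. -/
abbrev I (m : ℤ) : PGCA := e (.I m)
/-- The basis vector `J_m`. -/
abbrev J (m : ℤ) : PGCA := e (.J m)

theorem single_eq (g : PGCAGen) (r : ℂ) : (Finsupp.single g r : PGCAGen →₀ ℂ) = r • e g :=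
  (Finsupp.smul_single_one g r).symm

theorem lie_e (g h : PGCAGen) : ⁅e g, e h⁆ = (g.bracket h : PGCA) :=
  (bilinearExtension_single _ g h 1 1).trans (by simp)

end PGCA

/-! ### The universal central extension -/

/-- Labels of the basis of the universal central extension of the planar Galilean conformal
algebra; `C 0, C 1, C 2` label the central elements `C₁, C₂, C₃`. -/
inductive PGCAExtGen : Type
  | L (m : ℤ)
  | H (m : ℤ)
  | I (m : ℤ)
  | J (m : ℤ)
  | C (s : Fin 3)

/-- The brackets of basis vectors of the universal central extension of the planar Galilean
conformal algebra. -/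
def PGCAExtGen.bracket : PGCAExtGen → PGCAExtGen → (PGCAExtGen →₀ ℂ)
  | .L n, .L m => Finsupp.single (.L (m + n)) ((m : ℂ) - n) +
      Finsupp.single (.C 0) (if m + n = 0 then (n : ℂ) ^ 3 else 0)
  | .L n, .H m => Finsupp.single (.H (m + n)) (m : ℂ) +
      Finsupp.single (.C 1) (if m + n = 0 then (n : ℂ) ^ 2 else 0)
  | .H n, .H m => Finsupp.single (.C 2) (if m + n = 0 then (n : ℂ) else 0)
  | .L n, .I m => Finsupp.single (.I (m + n)) ((m : ℂ) - n)
  | .L n, .J m => Finsupp.single (.J (m + n)) ((m : ℂ) - n)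
  | .H n, .I m => Finsupp.single (.I (m + n)) 1
  | .H n, .J m => Finsupp.single (.J (m + n)) (-1)
  | .H m, .L n => - (Finsupp.single (.H (m + n)) (m : ℂ) +
      Finsupp.single (.C 1) (if m + n = 0 then (n : ℂ) ^ 2 else 0))
  | .I m, .L n => - Finsupp.single (.I (m + n)) ((m : ℂ) - n)
  | .J m, .L n => - Finsupp.single (.J (m + n)) ((m : ℂ) - n)
  | .I m, .H n => - Finsupp.single (.I (m + n)) 1
  | .J m, .H n => - Finsupp.single (.J (m + n)) (-1)
  | .I _, .I _ => 0
  | .I _, .J _ => 0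
  | .J _, .I _ => 0
  | .J _, .J _ => 0
  | .C _, _ => 0
  | _, .C _ => 0

/-- The universal central extension `𝒢̃` of the planar Galilean conformal algebra, with basis
`L_m, H_m, I_m, J_m, C₁, C₂, C₃` for `m : ℤ`. -/
def PGCAExt : Type := PGCAExtGen →₀ ℂ

instance : AddCommGroup PGCAExt := inferInstanceAs (AddCommGroup (PGCAExtGen →₀ ℂ))
instance : Module ℂ PGCAExt := inferInstanceAs (Module ℂ (PGCAExtGen →₀ ℂ))

theorem PGCAExtGen.bracket_skew (i j : PGCAExtGen) : i.bracket j = - j.bracket i := by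
  cases i <;> cases j <;> simp only [PGCAExtGen.bracket, neg_neg, neg_zero]
  all_goals rename_i n m
  · rw [add_comm n m, neg_add, ← Finsupp.single_neg, ← Finsupp.single_neg, neg_sub]
    split_ifs with h
    · obtain rfl : m = -n := by omega
      congr 2; push_cast; ring
    · simp
  · rw [add_comm n m, ← Finsupp.single_neg]
    split_ifs with h
    · obtain rfl : m = -n := by omega
      congr 1; push_cast; ring
    · simp

set_option maxHeartbeats 2000000 in
theorem PGCAExtGen.bracket_jacobi (i j k : PGCAExtGen) :
    bilinearExtension PGCAExtGen.bracket (Finsupp.single i 1) (j.bracket k) =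
      bilinearExtension PGCAExtGen.bracket (i.bracket j) (Finsupp.single k 1) +
        bilinearExtension PGCAExtGen.bracket (Finsupp.single j 1) (i.bracket k) := by
  cases i <;> cases j <;> cases k <;> rename_i a b c <;>
    simp only [PGCAExtGen.bracket, bilinearExtension_single, map_neg, map_add, LinearMap.add_apply,
      map_zero, LinearMap.neg_apply, smul_add,
      LinearMap.zero_apply, smul_neg, smul_zero, neg_neg, neg_zero, add_zero, zero_add,
      add_assoc, add_comm, add_left_comm, Finsupp.smul_single, ← Finsupp.single_neg, neg_add,
      ← Finsupp.single_add, smul_eq_mul]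
  all_goals try first | (simp; done) | (congr 1; push_cast; ring; done)
  all_goals
    simp only [← add_assoc, ← Finsupp.single_add]
    by_cases h : a + b + c = 0
    · have hc : (c : ℂ) = - a - b := by
        have h2 : ((a + b + c : ℤ) : ℂ) = 0 := by rw [h]; simp
        push_cast at h2
        linear_combination h2
      simp only [h, if_true]
      first
      | (congr 2 <;> push_cast <;> rw [hc] <;> ring; done)
      | (rw [eq_comm, Finsupp.single_eq_zero]; push_cast; rw [hc]; ring; done)
      | (congr 1; push_cast; try rw [hc]
         ring; done)
    · simp only [h, if_false, mul_zero, neg_zero, add_zero, Finsupp.single_zero, zero_add]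
      try (congr 1; push_cast; ring; done)

instance : LieRing PGCAExt where
  bracket x y := bilinearExtension PGCAExtGen.bracket x y
  add_lie x y z := LinearMap.map_add₂ (bilinearExtension PGCAExtGen.bracket) x y z
  lie_add x y z := map_add (bilinearExtension PGCAExtGen.bracket x) y z
  lie_self := bilinearExtension_self _ PGCAExtGen.bracket_skew
  leibniz_lie := bilinearExtension_leibniz _ PGCAExtGen.bracket_jacobi

instance : LieAlgebra ℂ PGCAExt where
  lie_smul t x y := map_smul (bilinearExtension PGCAExtGen.bracket x) t y

namespace PGCAExt

/-- The basis vector of `𝒢̃` with label `g`. -/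
def e (g : PGCAExtGen) : PGCAExt := Finsupp.single g (1 : ℂ)

/-- The basis vector `L_m`. -/
abbrev L (m : ℤ) : PGCAExt := e (.L m)
/-- The basis vector `H_m`. -/
abbrev H (m : ℤ) : PGCAExt := e (.H m)
/-- The basis vector `I_m`. -/
abbrev I (m : ℤ) : PGCAExt := e (.I m)
/-- The basis vector `J_m`. -/
abbrev J (m : ℤ) : PGCAExt := e (.J m)
/-- The central basis vectors; `C 0, C 1, C 2` are `C₁, C₂, C₃`. -/
abbrev C (s : Fin 3) : PGCAExt := e (.C s)

theorem single_eq (g : PGCAExtGen) (r : ℂ) : (Finsupp.single g r : PGCAExtGen →₀ ℂ) = r • e g :=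
  (Finsupp.smul_single_one g r).symm

theorem lie_e (g h : PGCAExtGen) : ⁅e g, e h⁆ = (g.bracket h : PGCAExt) :=
  (bilinearExtension_single _ g h 1 1).trans (by simp)

end PGCAExt

/-! ### The positive parts and the ideals `ℐ`, `𝒥` -/

theorem lie_mem_span_of_generators {𝔤 : Type} [LieRing 𝔤] [LieAlgebra ℂ 𝔤] {S T : Set 𝔤}
    {W : Submodule ℂ 𝔤} (h : ∀ x ∈ S, ∀ y ∈ T, ⁅x, y⁆ ∈ W) {x y : 𝔤}
    (hx : x ∈ Submodule.span ℂ S) (hy : y ∈ Submodule.span ℂ T) : ⁅x, y⁆ ∈ W := by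
  induction hx using Submodule.span_induction with
  | zero => simp
  | add x x' _ _ h1 h2 => rw [add_lie]; exact W.add_mem h1 h2
  | smul a x _ h1 => rw [smul_lie]; exact W.smul_mem a h1
  | mem x hx =>
    induction hy using Submodule.span_induction with
    | zero => simp
    | add y y' _ _ h1 h2 => rw [lie_add]; exact W.add_mem h1 h2
    | smul a y _ h1 => rw [lie_smul]; exact W.smul_mem a h1
    | mem y hy => exact h x hx y hy

namespace PGCA

theorem span_range_e : Submodule.span ℂ (Set.range e) = ⊤ := by
  rw [eq_top_iff]
  rintro x -
  induction x using Finsupp.induction_linear with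
  | zero => exact Submodule.zero_mem _
  | add x y hx hy => exact Submodule.add_mem _ hx hy
  | single g r =>
    rw [single_eq]
    exact Submodule.smul_mem _ _ (Submodule.subset_span ⟨g, rfl⟩)

/-- The basis of the positive part: `L_m, H_m, I_m, J_m` with `m ≥ 1`. -/
def posGenerators : Set PGCA :=
  {x | ∃ m : ℤ, 1 ≤ m ∧ (x = L m ∨ x = H m ∨ x = I m ∨ x = J m)}

/-- The positive part `𝒢⁺`, the span of `L_m, H_m, I_m, J_m` with `m ≥ 1`. -/
def pos : LieSubalgebra ℂ PGCA where
  toSubmodule := Submodule.span ℂ posGenerators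
  lie_mem' := by
    refine lie_mem_span_of_generators ?_
    rintro x ⟨n, hn, hx⟩ y ⟨m, hm, hy⟩
    have hs : ∀ z, (∃ k : ℤ, 1 ≤ k ∧ (z = L k ∨ z = H k ∨ z = I k ∨ z = J k)) →
        z ∈ Submodule.span ℂ posGenerators := fun z hz => Submodule.subset_span hz
    rcases hx with rfl | rfl | rfl | rfl <;> rcases hy with rfl | rfl | rfl | rfl <;>
      rw [lie_e] <;> simp only [PGCAGen.bracket, single_eq] <;>
      first
      | exact Submodule.zero_mem _
      | exact Submodule.smul_mem _ _ (hs _ ⟨m + n, by omega, by simp⟩)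
      | exact Submodule.neg_mem _ (Submodule.smul_mem _ _ (hs _ ⟨m + n, by omega, by simp⟩))
      | exact Submodule.neg_mem _ (Submodule.smul_mem _ _ (hs _ ⟨n + m, by omega, by simp⟩))

/-- The ideal `ℐ`, the span of all `I_m`. -/
def idealI : LieIdeal ℂ PGCA where
  toSubmodule := Submodule.span ℂ (Set.range I)
  lie_mem := by
    intro x m hm
    refine lie_mem_span_of_generators ?_
      (show x ∈ Submodule.span ℂ (Set.range e) from span_range_e ▸ Submodule.mem_top) hm
    rintro _ ⟨g, rfl⟩ _ ⟨k, rfl⟩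
    have hs : ∀ j, I j ∈ Submodule.span ℂ (Set.range I) := fun j => Submodule.subset_span ⟨j, rfl⟩
    cases g <;> rw [lie_e] <;> simp only [PGCAGen.bracket, single_eq] <;>
      first
      | exact Submodule.zero_mem _
      | exact Submodule.smul_mem _ _ (hs _)

/-- The ideal `𝒥`, the span of all `J_m`. -/
def idealJ : LieIdeal ℂ PGCA where
  toSubmodule := Submodule.span ℂ (Set.range J)
  lie_mem := by
    intro x m hm
    refine lie_mem_span_of_generators ?_
      (show x ∈ Submodule.span ℂ (Set.range e) from span_range_e ▸ Submodule.mem_top) hm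
    rintro _ ⟨g, rfl⟩ _ ⟨k, rfl⟩
    have hs : ∀ j, J j ∈ Submodule.span ℂ (Set.range J) := fun j => Submodule.subset_span ⟨j, rfl⟩
    cases g <;> rw [lie_e] <;> simp only [PGCAGen.bracket, single_eq] <;>
      first
      | exact Submodule.zero_mem _
      | exact Submodule.smul_mem _ _ (hs _)

/-- `I_1` as an element of `𝒢⁺`. -/
def posI : pos := ⟨I 1, Submodule.subset_span ⟨1, le_rfl, by simp⟩⟩
/-- `J_1` as an element of `𝒢⁺`. -/
def posJ : pos := ⟨J 1, Submodule.subset_span ⟨1, le_rfl, by simp⟩⟩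

end PGCA

namespace PGCAExt

theorem span_range_e : Submodule.span ℂ (Set.range e) = ⊤ := by
  rw [eq_top_iff]
  rintro x -
  induction x using Finsupp.induction_linear with
  | zero => exact Submodule.zero_mem _
  | add x y hx hy => exact Submodule.add_mem _ hx hy
  | single g r =>
    rw [single_eq]
    exact Submodule.smul_mem _ _ (Submodule.subset_span ⟨g, rfl⟩)

/-- The basis of the positive part: `L_m, H_m, I_m, J_m` with `m ≥ 1`. -/
def posGenerators : Set PGCAExt :=
  {x | ∃ m : ℤ, 1 ≤ m ∧ (x = L m ∨ x = H m ∨ x = I m ∨ x = J m)}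

/-- The positive part `𝒢̃⁺`, the span of `L_m, H_m, I_m, J_m` with `m ≥ 1`. -/
def pos : LieSubalgebra ℂ PGCAExt where
  toSubmodule := Submodule.span ℂ posGenerators
  lie_mem' := by
    refine lie_mem_span_of_generators ?_
    rintro x ⟨n, hn, hx⟩ y ⟨m, hm, hy⟩
    have hs : ∀ z, (∃ k : ℤ, 1 ≤ k ∧ (z = L k ∨ z = H k ∨ z = I k ∨ z = J k)) →
        z ∈ Submodule.span ℂ posGenerators := fun z hz => Submodule.subset_span hz
    have h0 : ¬ m + n = 0 := by omega
    have h1 : ¬ n + m = 0 := by omega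
    rcases hx with rfl | rfl | rfl | rfl <;> rcases hy with rfl | rfl | rfl | rfl <;>
      rw [lie_e] <;> simp only [PGCAExtGen.bracket, if_neg h0, if_neg h1, Finsupp.single_zero,
        add_zero] <;> try simp only [single_eq]
    all_goals
      first
      | exact Submodule.zero_mem _
      | exact Submodule.smul_mem _ _ (hs _ ⟨m + n, by omega, by simp⟩)
      | exact Submodule.neg_mem _ (Submodule.smul_mem _ _ (hs _ ⟨m + n, by omega, by simp⟩))
      | exact Submodule.neg_mem _ (Submodule.smul_mem _ _ (hs _ ⟨n + m, by omega, by simp⟩))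

/-- The ideal `ℐ`, the span of all `I_m`. -/
def idealI : LieIdeal ℂ PGCAExt where
  toSubmodule := Submodule.span ℂ (Set.range I)
  lie_mem := by
    intro x m hm
    refine lie_mem_span_of_generators ?_
      (show x ∈ Submodule.span ℂ (Set.range e) from span_range_e ▸ Submodule.mem_top) hm
    rintro _ ⟨g, rfl⟩ _ ⟨k, rfl⟩
    have hs : ∀ j, I j ∈ Submodule.span ℂ (Set.range I) := fun j => Submodule.subset_span ⟨j, rfl⟩
    cases g <;> rw [lie_e] <;> simp only [PGCAExtGen.bracket, single_eq] <;>
      first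
      | exact Submodule.zero_mem _
      | exact Submodule.smul_mem _ _ (hs _)

/-- The ideal `𝒥`, the span of all `J_m`. -/
def idealJ : LieIdeal ℂ PGCAExt where
  toSubmodule := Submodule.span ℂ (Set.range J)
  lie_mem := by
    intro x m hm
    refine lie_mem_span_of_generators ?_
      (show x ∈ Submodule.span ℂ (Set.range e) from span_range_e ▸ Submodule.mem_top) hm
    rintro _ ⟨g, rfl⟩ _ ⟨k, rfl⟩
    have hs : ∀ j, J j ∈ Submodule.span ℂ (Set.range J) := fun j => Submodule.subset_span ⟨j, rfl⟩
    cases g <;> rw [lie_e] <;> simp only [PGCAExtGen.bracket, single_eq] <;>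
      first
      | exact Submodule.zero_mem _
      | exact Submodule.smul_mem _ _ (hs _)

end PGCAExt

/-! ### The identification `𝒢̃⁺ = 𝒢⁺` -/

namespace PGCAExt

/-- The image of a basis vector of `𝒢̃` in `𝒢`. -/
def projGen : PGCAExtGen → PGCA
  | .L m => PGCA.L m
  | .H m => PGCA.H m
  | .I m => PGCA.I m
  | .J m => PGCA.J m
  | .C _ => 0

/-- The linear map underlying the projection `𝒢̃ → 𝒢`. -/
def projLinear : PGCAExt →ₗ[ℂ] PGCA := Finsupp.linearCombination ℂ projGen

theorem projLinear_single (g : PGCAExtGen) (r : ℂ) :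
    projLinear (Finsupp.single g r : PGCAExtGen →₀ ℂ) = r • projGen g :=
  Finsupp.linearCombination_single ℂ r g

theorem projLinear_e (g : PGCAExtGen) : projLinear (e g) = projGen g :=
  (projLinear_single g 1).trans (one_smul _ _)

theorem projLinear_bracket (g h : PGCAExtGen) :
    Finsupp.linearCombination ℂ projGen (g.bracket h) = ⁅projGen g, projGen h⁆ := by
  cases g <;> cases h <;>
    simp only [PGCAExtGen.bracket, map_add, map_neg, map_zero, Finsupp.linearCombination_single,
      projGen, PGCA.lie_e, PGCAGen.bracket, lie_zero, zero_lie, PGCA.single_eq, smul_zero,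
      add_zero] <;>
    rfl

/-- The projection `𝒢̃ → 𝒢` that sends `L_m, H_m, I_m, J_m` to `L_m, H_m, I_m, J_m` and
`C₁, C₂, C₃` to `0`. -/
def proj : PGCAExt →ₗ⁅ℂ⁆ PGCA where
  toLinearMap := projLinear
  map_lie' := by
    intro x y
    change projLinear ⁅x, y⁆ = ⁅projLinear x, projLinear y⁆
    have hx : x ∈ Submodule.span ℂ (Set.range e) := span_range_e ▸ Submodule.mem_top
    have hy : y ∈ Submodule.span ℂ (Set.range e) := span_range_e ▸ Submodule.mem_top
    induction hx using Submodule.span_induction with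
    | zero => simp
    | add x x' _ _ h1 h2 => simp only [add_lie, map_add, h1, h2]
    | smul a x _ h1 => simp only [smul_lie, map_smul, h1]
    | mem x hx =>
      induction hy using Submodule.span_induction with
      | zero => simp
      | add y y' _ _ h1 h2 => simp only [lie_add, map_add, h1, h2]
      | smul a y _ h1 => simp only [lie_smul, map_smul, h1]
      | mem y hy =>
        obtain ⟨g, rfl⟩ := hx
        obtain ⟨h, rfl⟩ := hy
        rw [lie_e, projLinear_e, projLinear_e]
        exact projLinear_bracket g h

theorem proj_e (g : PGCAExtGen) : proj (e g) = projGen g := projLinear_e g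

/-- The label in `𝒢̃` of a basis vector of `𝒢`. -/
def ofGen : PGCAGen → PGCAExtGen
  | .L m => .L m
  | .H m => .H m
  | .I m => .I m
  | .J m => .J m

/-- The linear section `𝒢 → 𝒢̃` that sends basis vectors to basis vectors of the same name. -/
def sec : PGCA →ₗ[ℂ] PGCAExt := Finsupp.linearCombination ℂ (fun g => e (ofGen g))

theorem sec_e (g : PGCAGen) : sec (PGCA.e g) = e (ofGen g) :=
  (Finsupp.linearCombination_single ℂ (1 : ℂ) g).trans (one_smul _ _)

theorem proj_mem_pos {x : PGCAExt} (hx : x ∈ pos) : proj x ∈ PGCA.pos := by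
  change x ∈ Submodule.span ℂ posGenerators at hx
  induction hx using Submodule.span_induction with
  | zero => simp
  | add x y _ _ h1 h2 => rw [map_add]; exact PGCA.pos.add_mem h1 h2
  | smul a x _ h1 => rw [map_smul]; exact PGCA.pos.smul_mem a h1
  | mem x hx =>
    obtain ⟨m, hm, rfl | rfl | rfl | rfl⟩ := hx <;> rw [proj_e] <;>
      exact Submodule.subset_span ⟨m, hm, by simp [projGen]⟩

theorem sec_mem_pos {x : PGCA} (hx : x ∈ PGCA.pos) : sec x ∈ pos := by
  change x ∈ Submodule.span ℂ PGCA.posGenerators at hx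
  induction hx using Submodule.span_induction with
  | zero => simp
  | add x y _ _ h1 h2 => rw [map_add]; exact pos.add_mem h1 h2
  | smul a x _ h1 => rw [map_smul]; exact pos.smul_mem a h1
  | mem x hx =>
    obtain ⟨m, hm, rfl | rfl | rfl | rfl⟩ := hx <;> rw [sec_e] <;>
      exact Submodule.subset_span ⟨m, hm, by simp [ofGen]⟩

theorem sec_proj {x : PGCAExt} (hx : x ∈ pos) : sec (proj x) = x := by
  change x ∈ Submodule.span ℂ posGenerators at hx
  induction hx using Submodule.span_induction with
  | zero => simp
  | add x y _ _ h1 h2 => rw [map_add, map_add, h1, h2]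
  | smul a x _ h1 => rw [map_smul, map_smul, h1]
  | mem x hx =>
    obtain ⟨m, hm, rfl | rfl | rfl | rfl⟩ := hx <;> rw [proj_e] <;> exact sec_e _

theorem proj_sec {x : PGCA} (hx : x ∈ PGCA.pos) : proj (sec x) = x := by
  change x ∈ Submodule.span ℂ PGCA.posGenerators at hx
  induction hx using Submodule.span_induction with
  | zero => simp
  | add x y _ _ h1 h2 => rw [map_add, map_add, h1, h2]
  | smul a x _ h1 => rw [map_smul, map_smul, h1]
  | mem x hx =>
    obtain ⟨m, hm, rfl | rfl | rfl | rfl⟩ := hx <;> rw [sec_e] <;> exact proj_e _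

/-- The identification `𝒢̃⁺ = 𝒢⁺`: the Lie algebra isomorphism that matches basis vectors of the
same name. -/
def posEquiv : pos ≃ₗ⁅ℂ⁆ PGCA.pos where
  toFun x := ⟨proj x, proj_mem_pos x.2⟩
  map_add' x y := Subtype.ext (map_add proj (x : PGCAExt) y)
  map_smul' a x := Subtype.ext (map_smul proj a (x : PGCAExt))
  map_lie' := Subtype.ext (proj.map_lie _ _)
  invFun x := ⟨sec x, sec_mem_pos x.2⟩
  left_inv x := Subtype.ext (sec_proj x.2)
  right_inv x := Subtype.ext (proj_sec x.2)

end PGCAExt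

/-! ### Induced modules and Whittaker modules -/

/-- The universal enveloping algebra `U(𝔤)`. -/
abbrev UEA (𝔤 : Type) [LieRing 𝔤] [LieAlgebra ℂ 𝔤] : Type := UniversalEnvelopingAlgebra ℂ 𝔤

/-- The canonical map `𝔤 → U(𝔤)`. -/
abbrev UEA.ι {𝔤 : Type} [LieRing 𝔤] [LieAlgebra ℂ 𝔤] : 𝔤 → UEA 𝔤 :=
  UniversalEnvelopingAlgebra.ι ℂ

/-- The algebra homomorphism `U(𝔭) → U(𝔤)` induced by the inclusion of a subalgebra. -/
def UEA.incl {𝔤 : Type} [LieRing 𝔤] [LieAlgebra ℂ 𝔤] (𝔭 : LieSubalgebra ℂ 𝔤) :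
    UEA 𝔭 →ₐ[ℂ] UEA 𝔤 :=
  UniversalEnvelopingAlgebra.lift ℂ ((UniversalEnvelopingAlgebra.ι ℂ).comp 𝔭.incl)

section Induced

open TensorProduct

variable {A B : Type} [Ring A] [Algebra ℂ A] [Ring B] [Algebra ℂ B] (f : A →ₐ[ℂ] B)
  (N : Type) [AddCommGroup N] [Module ℂ N] [Module A N] [IsScalarTower ℂ A N]

/-- The relations `b f(a) ⊗ n = b ⊗ a n` of the tensor product over `A`; they span a
`B`-submodule of `B ⊗[ℂ] N`. -/
def balancedRelations : Submodule B (B ⊗[ℂ] N) :=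
  Submodule.span B {t | ∃ (b : B) (a : A) (n : N), t = (b * f a) ⊗ₜ[ℂ] n - b ⊗ₜ[ℂ] (a • n)}

/-- The induced left `B`-module `B ⊗_A N`, where `B` is a right `A`-module through `f`. -/
abbrev InducedModule : Type := (B ⊗[ℂ] N) ⧸ balancedRelations f N

end Induced

/-- The one-dimensional `U(𝔭)`-module `ℂ_φ` on which `x ∈ 𝔭` acts as `φ(x)`. -/
def WhittakerLine {𝔭 : Type} [LieRing 𝔭] [LieAlgebra ℂ 𝔭]
    (_φ : LieAlgebra.LieCharacter ℂ 𝔭) : Type := ℂ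

section Whittaker

variable {𝔭 : Type} [LieRing 𝔭] [LieAlgebra ℂ 𝔭] (φ : LieAlgebra.LieCharacter ℂ 𝔭)

instance : AddCommGroup (WhittakerLine φ) := inferInstanceAs (AddCommGroup ℂ)
instance : Module ℂ (WhittakerLine φ) := inferInstanceAs (Module ℂ ℂ)
instance : Module (UEA 𝔭) (WhittakerLine φ) :=
  Module.compHom ℂ (UniversalEnvelopingAlgebra.lift ℂ φ : UEA 𝔭 →ₐ[ℂ] ℂ).toRingHom

/-- The basis vector `w_φ` of `ℂ_φ`. -/
def WhittakerLine.w : WhittakerLine φ := (1 : ℂ)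

theorem whittakerLine_smul (u : UEA 𝔭) (z : WhittakerLine φ) :
    u • z = (UniversalEnvelopingAlgebra.lift ℂ φ u : ℂ) • z := rfl

instance : IsScalarTower ℂ (UEA 𝔭) (WhittakerLine φ) where
  smul_assoc r u z := by
    simp only [whittakerLine_smul, map_smul, smul_assoc]

end Whittaker

/-- The universal Whittaker module `U(𝔤) ⊗_{U(𝔭)} ℂ_φ` for a character `φ` of a subalgebra. -/
abbrev UniversalWhittaker {𝔤 : Type} [LieRing 𝔤] [LieAlgebra ℂ 𝔤] (𝔭 : LieSubalgebra ℂ 𝔤)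
    (φ : LieAlgebra.LieCharacter ℂ 𝔭) : Type :=
  InducedModule (UEA.incl 𝔭) (WhittakerLine φ)

/-- `U(𝔤) 𝔞 V`, the `U(𝔤)`-submodule generated by all `x v` with `x ∈ 𝔞` and `v ∈ V`. -/
def idealAction {𝔤 : Type} [LieRing 𝔤] [LieAlgebra ℂ 𝔤] (𝔞 : LieIdeal ℂ 𝔤) (V : Type)
    [AddCommGroup V] [Module (UEA 𝔤) V] : Submodule (UEA 𝔤) V :=
  Submodule.span (UEA 𝔤) {w | ∃ x ∈ 𝔞, ∃ v : V, w = UEA.ι x • v}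

/-- A module is reducible if it has a submodule other than zero and itself. -/
def IsReducibleModule (R V : Type) [Ring R] [AddCommGroup V] [Module R V] : Prop :=
  ∃ N : Submodule R V, N ≠ ⊥ ∧ N ≠ ⊤

namespace PGCA

/-- `φ` is singular if `φ(I_1) φ(J_1) = 0`. -/
def IsSingular (φ : LieAlgebra.LieCharacter ℂ pos) : Prop := φ posI * φ posJ = 0

/-- The generic Whittaker `𝒢`-module `L_φ = M(φ)`. -/
abbrev GenericWhittaker (φ : LieAlgebra.LieCharacter ℂ pos) : Type := UniversalWhittaker pos φ

/-- `Ω_φ = U(𝒢)(ℐ ⊕ 𝒥) L_φ`. -/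
def Omega (φ : LieAlgebra.LieCharacter ℂ pos) : Submodule (UEA PGCA) (GenericWhittaker φ) :=
  idealAction (idealI ⊔ idealJ) (GenericWhittaker φ)

/-- `Γ_φ = U(𝒢) ℐ L_φ`. -/
def Gamma (φ : LieAlgebra.LieCharacter ℂ pos) : Submodule (UEA PGCA) (GenericWhittaker φ) :=
  idealAction idealI (GenericWhittaker φ)

/-- `Υ_φ = U(𝒢) 𝒥 L_φ`. -/
def Upsilon (φ : LieAlgebra.LieCharacter ℂ pos) : Submodule (UEA PGCA) (GenericWhittaker φ) :=
  idealAction idealJ (GenericWhittaker φ)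

end PGCA

namespace PGCAExt

/-- A character of `𝒢⁺` regarded as a character of `𝒢̃⁺ = 𝒢⁺`. -/
def extendChar (φ : LieAlgebra.LieCharacter ℂ PGCA.pos) : LieAlgebra.LieCharacter ℂ pos :=
  φ.comp posEquiv.toLieHom

/-- The universal Whittaker `𝒢̃`-module `M̃(φ)`. -/
abbrev MTilde (φ : LieAlgebra.LieCharacter ℂ PGCA.pos) : Type :=
  UniversalWhittaker pos (extendChar φ)

/-- `∑ₛ (C_s - ξ_s) M̃(φ)`. -/
def centralRelations (φ : LieAlgebra.LieCharacter ℂ PGCA.pos) (ξ : Fin 3 → ℂ) :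
    Submodule (UEA PGCAExt) (MTilde φ) :=
  Submodule.span (UEA PGCAExt)
    {w | ∃ (s : Fin 3) (v : MTilde φ), w = (UEA.ι (C s) - algebraMap ℂ (UEA PGCAExt) (ξ s)) • v}

/-- The generic Whittaker `𝒢̃`-module `L̃_{φ,ξ} = M̃(φ) / ∑ₛ (C_s - ξ_s) M̃(φ)`. -/
abbrev GenericWhittaker (φ : LieAlgebra.LieCharacter ℂ PGCA.pos) (ξ : Fin 3 → ℂ) : Type :=
  MTilde φ ⧸ centralRelations φ ξ

/-- `(H_0 - c) L̃_{φ,ξ} + U(𝒢̃)(ℐ ⊕ 𝒥) L̃_{φ,ξ}`, as a linear subspace. -/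
def OmegaTilde (φ : LieAlgebra.LieCharacter ℂ PGCA.pos) (ξ : Fin 3 → ℂ) (c : ℂ) :
    Submodule ℂ (GenericWhittaker φ ξ) :=
  (idealAction (idealI ⊔ idealJ) (GenericWhittaker φ ξ)).restrictScalars ℂ ⊔
    LinearMap.range
      (Algebra.lsmul ℂ ℂ (GenericWhittaker φ ξ) (UEA.ι (H 0) - algebraMap ℂ (UEA PGCAExt) c))

/-- `Γ̃_{φ,ξ} = U(𝒢̃) ℐ L̃_{φ,ξ}`. -/
def GammaTilde (φ : LieAlgebra.LieCharacter ℂ PGCA.pos) (ξ : Fin 3 → ℂ) :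
    Submodule (UEA PGCAExt) (GenericWhittaker φ ξ) :=
  idealAction idealI (GenericWhittaker φ ξ)

/-- `Υ̃_{φ,ξ} = U(𝒢̃) 𝒥 L̃_{φ,ξ}`. -/
def UpsilonTilde (φ : LieAlgebra.LieCharacter ℂ PGCA.pos) (ξ : Fin 3 → ℂ) :
    Submodule (UEA PGCAExt) (GenericWhittaker φ ξ) :=
  idealAction idealJ (GenericWhittaker φ ξ)

end PGCAExt

end

noncomputable section

attribute [local instance] LieRing.ofAssociativeRing

/-! ### Generalities on enveloping algebras -/

namespace UEA

variable {𝔤 : Type} [LieRing 𝔤] [LieAlgebra ℂ 𝔤]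

/-! A Whittaker module maps onto `U(𝔤)/K`, with cyclic vector going to the class of 1, whenever the
left ideal `K` contains all `x - φ(x)` with `x` positive (and, for the extension, all right
multiples of `C_s - ξ_s`). Suitable `K` arise by extending φ to a character χ of a larger subalgebra
𝔭 and letting `K` be generated by the `x - χ(x)`, `x ∈ 𝔭`. Each assertion is read off from one such
quotient.

Proper: let 𝔭 contain all of ℐ and let χ vanish there, which is possible when φ(I_1) = 0. Since ℐ is
an ideal, it acts by zero on the whole of `U(𝔤)/K`, so the submodule generated by `ℐV` lies in the
kernel of a nonzero map. The same works for 𝒥 and for ℐ ⊕ 𝒥. In the last case `H_0` can be added to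
𝔭 with χ(H_0) = c, and `H_0 - c` also acts by zero, because `H_0` is central modulo ℐ ⊕ 𝒥. Nonzero:
let 𝔭 be the positive part together with `I_0`, and set χ(I_0) = 1. Then `I_0` applied to the cyclic
vector has image 1.

Everything thus rests on `1 ∉ K`, which is `one_notMem_characterIdeal_of_isCompl`. If 𝔭 has a
complementary subalgebra 𝔫, the induced module is realised on the space `U(𝔫)`, and `K` annihilates
the nonzero vector 1 there. The realisation is built by hand (`MatchedPair.action`), so the
Poincaré–Birkhoff–Witt theorem is not used. -/

theorem ι_lie (x y : 𝔤) : (ι ⁅x, y⁆ : UEA 𝔤) = ι x * ι y - ι y * ι x :=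
  (UniversalEnvelopingAlgebra.ι ℂ).map_lie x y

/-- By the universal property, `ι` corestricted to the adjoined subalgebra lifts to `U(𝔤)`. Followed
by the inclusion, this lift is the identity. -/
theorem adjoin_range_ι : Algebra.adjoin ℂ (Set.range (ι : 𝔤 → UEA 𝔤)) = ⊤ := by
  set S := Algebra.adjoin ℂ (Set.range (ι : 𝔤 → UEA 𝔤)) with hS
  let f : 𝔤 →ₗ⁅ℂ⁆ S :=
    { toFun := fun x => ⟨ι x, Algebra.subset_adjoin ⟨x, rfl⟩⟩
      map_add' := fun x y => Subtype.ext (map_add (UniversalEnvelopingAlgebra.ι ℂ) x y)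
      map_smul' := fun a x => Subtype.ext (map_smul (UniversalEnvelopingAlgebra.ι ℂ) a x)
      map_lie' := Subtype.ext (ι_lie _ _) }
  have h : S.val.comp (UniversalEnvelopingAlgebra.lift ℂ f) = AlgHom.id ℂ (UEA 𝔤) := by
    apply UniversalEnvelopingAlgebra.hom_ext
    ext x
    change S.val (UniversalEnvelopingAlgebra.lift ℂ f (UniversalEnvelopingAlgebra.ι ℂ x)) = _
    rw [UniversalEnvelopingAlgebra.lift_ι_apply]
    rfl
  rw [eq_top_iff]
  rintro u -
  have := DFunLike.congr_fun h u
  change ((UniversalEnvelopingAlgebra.lift ℂ f u : S) : UEA 𝔤) = u at this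
  rw [← this]
  exact Subtype.property _

/-- A linear subspace that is stable under the elements of `𝔤` is stable under `U(𝔤)`. -/
theorem smul_mem_of_ι_smul_mem {V : Type} [AddCommGroup V] [Module ℂ V] [Module (UEA 𝔤) V]
    [IsScalarTower ℂ (UEA 𝔤) V] (W : Submodule ℂ V)
    (h : ∀ (x : 𝔤), ∀ v ∈ W, (ι x : UEA 𝔤) • v ∈ W) (u : UEA 𝔤) {v : V} (hv : v ∈ W) :
    u • v ∈ W := by
  have hu : u ∈ Algebra.adjoin ℂ (Set.range (ι : 𝔤 → UEA 𝔤)) := by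
    rw [adjoin_range_ι]; trivial
  induction hu using Algebra.adjoin_induction generalizing v with
  | mem u hu => obtain ⟨x, rfl⟩ := hu; exact h x v hv
  | algebraMap r => rw [algebraMap_smul]; exact W.smul_mem r hv
  | add a b _ _ ha hb => rw [add_smul]; exact W.add_mem (ha hv) (hb hv)
  | mul a b _ _ ha hb => rw [mul_smul]; exact ha (hb hv)

theorem left_induction (W : Submodule ℂ (UEA 𝔤)) (h1 : 1 ∈ W)
    (h : ∀ (x : 𝔤), ∀ v ∈ W, ι x * v ∈ W) (u : UEA 𝔤) : u ∈ W := by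
  simpa using smul_mem_of_ι_smul_mem (𝔤 := 𝔤) W h u h1

/-- The trivial representation sends 1 to 1 in ℂ. Applied to `U(𝔫)`, this is the only nonvanishing
fact that the whole argument needs. -/
instance : Nontrivial (UEA 𝔤) :=
  (UniversalEnvelopingAlgebra.lift ℂ (0 : 𝔤 →ₗ⁅ℂ⁆ ℂ)).toRingHom.domain_nontrivial

end UEA

/-! ### Modules obtained from a decomposition into two subalgebras -/

namespace MatchedPair

variable {𝔤 : Type} [LieRing 𝔤] [LieAlgebra ℂ 𝔤] (𝔫 : LieSubalgebra ℂ 𝔤)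

/-- The action of `𝔫` on `Hom(𝔤, U(𝔫))`. -/
def homAction : 𝔫 →ₗ⁅ℂ⁆ Module.End ℂ (𝔤 →ₗ[ℂ] UEA 𝔫) where
  toFun y :=
    { toFun := fun F =>
        { toFun := fun x => UEA.ι y * F x - F ⁅(y : 𝔤), x⁆
          map_add' := fun x x' => by simp only [map_add, lie_add, mul_add]; abel
          map_smul' := fun a x => by
            simp only [map_smul, lie_smul, mul_smul_comm, smul_sub, RingHom.id_apply] }
      map_add' := fun F F' => by
        ext x; simp only [LinearMap.add_apply, LinearMap.coe_mk, AddHom.coe_mk, mul_add]; abel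
      map_smul' := fun a F => by
        ext x
        simp only [LinearMap.smul_apply, LinearMap.coe_mk, AddHom.coe_mk, mul_smul_comm, smul_sub,
          RingHom.id_apply] }
  map_add' y y' := by
    ext F x
    simp only [LinearMap.add_apply, LinearMap.coe_mk, AddHom.coe_mk, map_add, add_mul,
      show ((y + y' : 𝔫) : 𝔤) = y + y' from rfl, add_lie]
    abel
  map_smul' a y := by
    ext F x
    simp only [LinearMap.smul_apply, LinearMap.coe_mk, AddHom.coe_mk, map_smul, smul_mul_assoc,
      show ((a • y : 𝔫) : 𝔤) = a • (y : 𝔤) from rfl, smul_lie, smul_sub, RingHom.id_apply]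
  map_lie' := by
    intro y y'
    ext F x
    simp only [LieRing.of_associative_ring_bracket, LinearMap.sub_apply, Module.End.mul_apply,
      LinearMap.coe_mk, AddHom.coe_mk, UEA.ι_lie, LieSubalgebra.coe_bracket, lie_lie, map_sub,
      sub_mul, mul_sub, mul_assoc]
    abel

theorem homAction_apply (y : 𝔫) (F : 𝔤 →ₗ[ℂ] UEA 𝔫) (x : 𝔤) :
    homAction 𝔫 y F x = UEA.ι y * F x - F ⁅(y : 𝔤), x⁆ := rfl

/-- The action of `𝔤` on `U(𝔫)` for which `x • 1 = F x`. -/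
def action (F : 𝔤 →ₗ[ℂ] UEA 𝔫) : 𝔤 →ₗ[ℂ] Module.End ℂ (UEA 𝔫) :=
  ((LinearMap.applyₗ F).comp
    (UniversalEnvelopingAlgebra.lift ℂ (homAction 𝔫)).toLinearMap).flip

variable {𝔫} (F : 𝔤 →ₗ[ℂ] UEA 𝔫)

theorem action_one (x : 𝔤) : action 𝔫 F x 1 = F x := by
  change (UniversalEnvelopingAlgebra.lift ℂ (homAction 𝔫) 1) F x = F x
  rw [map_one]; rfl

/-- The rule xy = yx + [x,y] is built into `homAction`: its term `-F [y,x]` becomes the action of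
[x,y]. With the values on 1 it determines the action on all of `U(𝔫)`. -/
theorem action_ι_mul (x : 𝔤) (y : 𝔫) (u : UEA 𝔫) :
    action 𝔫 F x (UEA.ι y * u) = UEA.ι y * action 𝔫 F x u + action 𝔫 F ⁅x, (y : 𝔤)⁆ u := by
  change (UniversalEnvelopingAlgebra.lift ℂ (homAction 𝔫) (UEA.ι y * u)) F x = _
  rw [map_mul, UEA.ι, UniversalEnvelopingAlgebra.lift_ι_apply, Module.End.mul_apply,
    homAction_apply, ← lie_skew, map_neg, sub_neg_eq_add]
  rfl

theorem action_of_mem (hF : ∀ y : 𝔫, F y = UEA.ι y) (y : 𝔫) (u : UEA 𝔫) :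
    action 𝔫 F y u = UEA.ι y * u := by
  -- The induction must run over all `y` at once: moving `y` past a factor `z` produces [y,z].
  suffices h : u ∈ ⨅ y : 𝔫, LinearMap.eqLocus (action 𝔫 F y) (LinearMap.mulLeft ℂ (UEA.ι y)) by
    simp only [Submodule.mem_iInf, LinearMap.mem_eqLocus] at h
    exact h y
  refine UEA.left_induction _ ?_ ?_ u
  · simp only [Submodule.mem_iInf, LinearMap.mem_eqLocus]
    intro y; simp [action_one, hF]
  · simp only [Submodule.mem_iInf, LinearMap.mem_eqLocus, LinearMap.mulLeft_apply]
    intro z u hu y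
    rw [action_ι_mul, hu, ← LieSubalgebra.coe_bracket, hu, UEA.ι_lie, sub_mul]
    simp only [mul_assoc]; abel

/-- The commutation rule settles brackets with one entry in 𝔫. On the vector 1, splitting both
entries along 𝔭 + 𝔫 leaves only pairs from 𝔭, where both sides vanish because χ is a character. The
Jacobi identity carries the result from `u` to `z u`. -/
theorem action_lie {𝔭 : LieSubalgebra ℂ 𝔤} (h𝔫 : 𝔭.toSubmodule ⊔ 𝔫.toSubmodule = ⊤)
    (hF : ∀ y : 𝔫, F y = UEA.ι y) (χ : 𝔤 →ₗ[ℂ] ℂ)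
    (hχ : ∀ x ∈ 𝔭, F x = algebraMap ℂ _ (χ x)) (hχ' : ∀ x ∈ 𝔭, ∀ y ∈ 𝔭, χ ⁅x, y⁆ = 0)
    (x y : 𝔤) : action 𝔫 F ⁅x, y⁆ = ⁅action 𝔫 F x, action 𝔫 F y⁆ := by
  have h1 : ∀ (x : 𝔤) (y : 𝔫), action 𝔫 F ⁅x, (y : 𝔤)⁆ = ⁅action 𝔫 F x, action 𝔫 F y⁆ := by
    intro x y
    ext u
    rw [LieRing.of_associative_ring_bracket, LinearMap.sub_apply, Module.End.mul_apply,
      Module.End.mul_apply, action_of_mem F hF, action_of_mem F hF, action_ι_mul]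
    abel
  have h1' : ∀ (y : 𝔫) (x : 𝔤), action 𝔫 F ⁅(y : 𝔤), x⁆ = ⁅action 𝔫 F y, action 𝔫 F x⁆ := by
    intro y x
    rw [← lie_skew, map_neg, h1, lie_skew]
  have key : ∀ u : UEA 𝔫, u ∈ ⨅ x : 𝔤, ⨅ y : 𝔤,
      LinearMap.eqLocus (action 𝔫 F ⁅x, y⁆) ⁅action 𝔫 F x, action 𝔫 F y⁆ := by
    intro u
    refine UEA.left_induction _ ?_ ?_ u
    · simp only [Submodule.mem_iInf, LinearMap.mem_eqLocus]
      intro x y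
      obtain ⟨p, hp, n, hn, rfl⟩ := Submodule.mem_sup.mp (h𝔫 ▸ Submodule.mem_top (x := x))
      obtain ⟨q, hq, m, hm, rfl⟩ := Submodule.mem_sup.mp (h𝔫 ▸ Submodule.mem_top (x := y))
      have e1 := h1 p ⟨m, hm⟩
      have e2 := h1 n ⟨m, hm⟩
      have e3 := h1' ⟨n, hn⟩ q
      simp only [add_lie, lie_add, map_add, LinearMap.add_apply] at e1 e2 e3 ⊢
      rw [e1, e2, e3]
      -- Elements of 𝔭 act on 1 by scalars, so the commutator kills 1; on the other side χ[p,q] = 0.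
      have e4 : action 𝔫 F ⁅p, q⁆ 1 = ⁅action 𝔫 F p, action 𝔫 F q⁆ 1 := by
        have hs : ∀ (x : 𝔤) (r : ℂ), action 𝔫 F x (algebraMap ℂ (UEA 𝔫) r) = r • F x := by
          intro x r
          rw [Algebra.algebraMap_eq_smul_one, map_smul, action_one]
        rw [LieRing.of_associative_ring_bracket, LinearMap.sub_apply, Module.End.mul_apply,
          Module.End.mul_apply, action_one, action_one, action_one, hχ p hp, hχ q hq,
          hχ _ (𝔭.lie_mem hp hq), hχ' p hp q hq, hs, hs, hχ p hp, hχ q hq,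
          Algebra.smul_def, Algebra.smul_def, Algebra.commutes, sub_self, map_zero]
      rw [e4]
    · simp only [Submodule.mem_iInf, LinearMap.mem_eqLocus]
      intro z u hu x y
      -- Pulling `z` out calls on the hypothesis for (x, y), ([x,z], y) and (x, [y,z]).
      have j : ⁅⁅x, y⁆, (z : 𝔤)⁆ = ⁅⁅x, (z : 𝔤)⁆, y⁆ + ⁅x, ⁅y, (z : 𝔤)⁆⁆ := by
        rw [leibniz_lie x y, ← lie_skew ⁅x, (z : 𝔤)⁆ y, lie_lie]
        rw [leibniz_lie x y]; abel
      have e0 := hu x y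
      have e1 := hu ⁅x, (z : 𝔤)⁆ y
      have e2 := hu x ⁅y, (z : 𝔤)⁆
      rw [LieRing.of_associative_ring_bracket, LinearMap.sub_apply, Module.End.mul_apply,
        Module.End.mul_apply] at e0 e1 e2 ⊢
      simp only [action_ι_mul, map_add, j, LinearMap.add_apply, e0, e1, e2, mul_sub]
      abel
  ext u
  have := key u
  simp only [Submodule.mem_iInf, LinearMap.mem_eqLocus] at this
  exact this x y

end MatchedPair

/-! ### The left ideal attached to a character -/

/-- The left ideal of `U(𝔤)` generated by all `x - χ(x)` with `x ∈ 𝔭`. -/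
def characterIdeal {𝔤 : Type} [LieRing 𝔤] [LieAlgebra ℂ 𝔤] (𝔭 : Submodule ℂ 𝔤)
    (χ : 𝔤 →ₗ[ℂ] ℂ) : Submodule (UEA 𝔤) (UEA 𝔤) :=
  Submodule.span (UEA 𝔤) {t | ∃ x ∈ 𝔭, t = UEA.ι x - algebraMap ℂ (UEA 𝔤) (χ x)}

section CharacterIdeal

variable {𝔤 : Type} [LieRing 𝔤] [LieAlgebra ℂ 𝔤] {𝔭 : Submodule ℂ 𝔤} {χ : 𝔤 →ₗ[ℂ] ℂ}

/-- `U(𝔫)` becomes a 𝔤-module in which 𝔫 acts by left multiplication and each `x ∈ 𝔭` sends 1 to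
χ(x). The left ideal annihilates the vector 1, whereas the unit fixes it. -/
theorem one_notMem_characterIdeal_of_isCompl (𝔭 𝔫 : LieSubalgebra ℂ 𝔤)
    (h : IsCompl 𝔭.toSubmodule 𝔫.toSubmodule) (χ : 𝔤 →ₗ[ℂ] ℂ)
    (hχ : ∀ x ∈ 𝔭, ∀ y ∈ 𝔭, χ ⁅x, y⁆ = 0) :
    (1 : UEA 𝔤) ∉ characterIdeal 𝔭.toSubmodule χ := by
  let P : 𝔤 →ₗ[ℂ] 𝔭 := 𝔭.toSubmodule.projectionOnto 𝔫.toSubmodule h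
  let Q : 𝔤 →ₗ[ℂ] 𝔫 := 𝔫.toSubmodule.projectionOnto 𝔭.toSubmodule h.symm
  let F : 𝔤 →ₗ[ℂ] UEA 𝔫 :=
    (Algebra.linearMap ℂ (UEA 𝔫)).comp (χ.comp (𝔭.toSubmodule.subtype.comp P)) +
      (UniversalEnvelopingAlgebra.ι ℂ : 𝔫 →ₗ⁅ℂ⁆ UEA 𝔫).toLinearMap.comp Q
  have hF1 : ∀ y : 𝔫, F y = UEA.ι y := by
    intro y
    change algebraMap ℂ (UEA 𝔫) (χ (P y : 𝔤)) + UEA.ι (Q y) = UEA.ι y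
    rw [show P y = 0 from Submodule.projectionOnto_apply_right h y,
      show Q y = y from Submodule.projectionOnto_apply_left h.symm y]
    simp
  have hF2 : ∀ x ∈ 𝔭, F x = algebraMap ℂ _ (χ x) := by
    intro x hx
    change algebraMap ℂ (UEA 𝔫) (χ (P x : 𝔤)) +
      (UniversalEnvelopingAlgebra.ι ℂ : 𝔫 →ₗ⁅ℂ⁆ UEA 𝔫).toLinearMap (Q x) = _
    rw [show P x = ⟨x, hx⟩ from Submodule.projectionOnto_apply_left h ⟨x, hx⟩,
      show Q x = 0 from Submodule.projectionOnto_apply_right h.symm ⟨x, hx⟩, map_zero, add_zero]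
  let ρ : 𝔤 →ₗ⁅ℂ⁆ Module.End ℂ (UEA 𝔫) :=
    { MatchedPair.action 𝔫 F with
      map_lie' := MatchedPair.action_lie F h.sup_eq_top hF1 χ hF2 hχ _ _ }
  intro h1
  have h2 : ∀ u ∈ characterIdeal 𝔭.toSubmodule χ, UniversalEnvelopingAlgebra.lift ℂ ρ u 1 = 0 := by
    intro u hu
    induction hu using Submodule.span_induction with
    | zero => simp
    | add u v _ _ hu hv => rw [map_add, LinearMap.add_apply, hu, hv, add_zero]
    | smul a u _ hu => rw [smul_eq_mul, map_mul, Module.End.mul_apply, hu, map_zero]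
    | mem u hu =>
      obtain ⟨x, hx, rfl⟩ := hu
      rw [map_sub, UEA.ι, UniversalEnvelopingAlgebra.lift_ι_apply, AlgHom.commutes,
        LinearMap.sub_apply, Module.algebraMap_end_apply, ← Algebra.algebraMap_eq_smul_one,
        ← hF2 x hx, sub_eq_zero]
      exact MatchedPair.action_one F x
  have h3 := h2 1 h1
  rw [map_one (UniversalEnvelopingAlgebra.lift ℂ ρ), Module.End.one_apply] at h3
  exact one_ne_zero h3

theorem ι_sub_mem_characterIdeal {x : 𝔤} (hx : x ∈ 𝔭) :
    (UEA.ι x - algebraMap ℂ (UEA 𝔤) (χ x)) ∈ characterIdeal 𝔭 χ :=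
  Submodule.subset_span ⟨x, hx, rfl⟩

/-- Right multiples of `x - χ(x)` lie in the left ideal when `x` belongs to a `χ`-invariant
ideal. -/
theorem ι_sub_mul_mem_characterIdeal {𝔟 : Submodule ℂ 𝔤} (h𝔟 : 𝔟 ≤ 𝔭)
    (hlie : ∀ y : 𝔤, ∀ x ∈ 𝔟, ⁅y, x⁆ ∈ 𝔟 ∧ χ ⁅y, x⁆ = 0) {x : 𝔤} (hx : x ∈ 𝔟) (u : UEA 𝔤) :
    (UEA.ι x - algebraMap ℂ (UEA 𝔤) (χ x)) * u ∈ characterIdeal 𝔭 χ := by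
  -- Again all `x ∈ 𝔟` are treated together, since (x - χ(x))yv = y(x - χ(x))v - [y,x]v brings in
  -- [y,x] ∈ 𝔟, on which χ is zero.
  suffices h : u ∈ ⨅ x ∈ 𝔟, ((characterIdeal 𝔭 χ).restrictScalars ℂ).comap
      (LinearMap.mulLeft ℂ (UEA.ι x - algebraMap ℂ (UEA 𝔤) (χ x))) by
    simp only [Submodule.mem_iInf] at h
    exact h x hx
  refine UEA.left_induction _ ?_ ?_ u
  · simp only [Submodule.mem_iInf, Submodule.mem_comap, LinearMap.mulLeft_apply, mul_one]
    exact fun x hx => ι_sub_mem_characterIdeal (h𝔟 hx)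
  · simp only [Submodule.mem_iInf, Submodule.mem_comap, LinearMap.mulLeft_apply,
      Submodule.restrictScalars_mem]
    intro y v hv x hx
    have h1 := hv _ (hlie y x hx).1
    rw [(hlie y x hx).2, map_zero, sub_zero, UEA.ι_lie] at h1
    have h2 := (characterIdeal 𝔭 χ).smul_mem (UEA.ι y) (hv x hx)
    have h3 := Submodule.sub_mem _ h2 h1
    convert h3 using 1
    simp only [smul_eq_mul, sub_mul, mul_sub, mul_assoc, Algebra.left_comm]
    abel

end CharacterIdeal

/-! ### Maps out of universal Whittaker modules -/

section WhittakerMap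

open TensorProduct

variable {𝔤 : Type} [LieRing 𝔤] [LieAlgebra ℂ 𝔤] {𝔭 : LieSubalgebra ℂ 𝔤}
  {φ : LieAlgebra.LieCharacter ℂ 𝔭}

/-- The step from `v` to `xv` is the identity xv - φ(x)φ(v) = x(v - φ(v)) + φ(v)(x - φ(x)), which
uses left multiples only. -/
theorem UEA.incl_sub_mem {K : Submodule (UEA 𝔤) (UEA 𝔤)}
    (hK : ∀ x : 𝔭, UEA.ι (x : 𝔤) - algebraMap ℂ (UEA 𝔤) (φ x) ∈ K) (a : UEA 𝔭) :
    UEA.incl 𝔭 a - algebraMap ℂ (UEA 𝔤) (UniversalEnvelopingAlgebra.lift ℂ φ a) ∈ K := by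
  let D : UEA 𝔭 →ₗ[ℂ] UEA 𝔤 := (UEA.incl 𝔭).toLinearMap -
    (Algebra.linearMap ℂ (UEA 𝔤)).comp (UniversalEnvelopingAlgebra.lift ℂ φ).toLinearMap
  change a ∈ (K.restrictScalars ℂ).comap D
  refine UEA.left_induction _ ?_ ?_ a
  · change UEA.incl 𝔭 1 - algebraMap ℂ (UEA 𝔤) (UniversalEnvelopingAlgebra.lift ℂ φ 1) ∈ K
    simp
  · intro x v hv
    change UEA.incl 𝔭 v - algebraMap ℂ (UEA 𝔤) (UniversalEnvelopingAlgebra.lift ℂ φ v) ∈ K at hv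
    change UEA.incl 𝔭 (UEA.ι x * v) -
      algebraMap ℂ (UEA 𝔤) (UniversalEnvelopingAlgebra.lift ℂ φ (UEA.ι x * v)) ∈ K
    have h1 : UEA.incl 𝔭 (UEA.ι x) = UEA.ι (x : 𝔤) :=
      UniversalEnvelopingAlgebra.lift_ι_apply ℂ _ x
    have h2 : UniversalEnvelopingAlgebra.lift ℂ φ (UEA.ι x) = φ x :=
      UniversalEnvelopingAlgebra.lift_ι_apply ℂ _ x
    have h3 := K.add_mem (K.smul_mem (UEA.ι (x : 𝔤)) hv)
      (K.smul_mem (algebraMap ℂ (UEA 𝔤) (UniversalEnvelopingAlgebra.lift ℂ φ v)) (hK x))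
    convert h3 using 1
    rw [map_mul, map_mul, h1, h2, map_mul, smul_eq_mul, smul_eq_mul, mul_sub, mul_sub,
      ← Algebra.commutes (UniversalEnvelopingAlgebra.lift ℂ φ v) (UEA.ι (x : 𝔤)),
      ← map_mul, ← map_mul, mul_comm (φ x)]
    abel

/-- The map `1 ⊗ w ↦ 1` from a universal Whittaker module to a quotient of `U(𝔤)`. -/
def whittakerMap (K : Submodule (UEA 𝔤) (UEA 𝔤))
    (hK : ∀ x : 𝔭, UEA.ι (x : 𝔤) - algebraMap ℂ (UEA 𝔤) (φ x) ∈ K) :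
    UniversalWhittaker 𝔭 φ →ₗ[UEA 𝔤] UEA 𝔤 ⧸ K :=
  Submodule.liftQ _ (K.mkQ.comp (TensorProduct.AlgebraTensorModule.lift
    ({ toFun := fun b => (LinearMap.toSpanSingleton ℂ (UEA 𝔤) b : ℂ →ₗ[ℂ] UEA 𝔤)
       map_add' := fun b b' => LinearMap.toSpanSingleton_add b b'
       map_smul' := fun u b => LinearMap.ext fun z => by
        let r : ℂ := z
        exact (mul_smul_comm r u b).symm } :
      UEA 𝔤 →ₗ[UEA 𝔤] WhittakerLine φ →ₗ[ℂ] UEA 𝔤))) (by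
    rw [balancedRelations, Submodule.span_le]
    rintro _ ⟨b, a, n, rfl⟩
    rw [SetLike.mem_coe, LinearMap.mem_ker, LinearMap.comp_apply, map_sub,
      TensorProduct.AlgebraTensorModule.lift_tmul, TensorProduct.AlgebraTensorModule.lift_tmul,
      Submodule.mkQ_apply, Submodule.Quotient.mk_eq_zero]
    let r : ℂ := n
    change r • (b * UEA.incl 𝔭 a) -
      ((UniversalEnvelopingAlgebra.lift ℂ φ a : ℂ) * r) • b ∈ K
    -- The balancing relation is sent to rb(a - φ(a)), a left multiple of an element of `K`.
    have h := K.smul_mem (algebraMap ℂ (UEA 𝔤) r * b) (UEA.incl_sub_mem hK a)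
    convert h using 1
    rw [smul_eq_mul, mul_sub, mul_assoc, mul_assoc, ← Algebra.commutes _ b, Algebra.smul_def,
      Algebra.smul_def, ← mul_assoc, ← mul_assoc, ← map_mul, mul_comm r])

variable (φ) in
/-- The cyclic vector `1 ⊗ w` of a universal Whittaker module. -/
def whittakerVector : UniversalWhittaker 𝔭 φ :=
  Submodule.Quotient.mk ((1 : UEA 𝔤) ⊗ₜ[ℂ] WhittakerLine.w φ)

theorem whittakerMap_vector (K : Submodule (UEA 𝔤) (UEA 𝔤))
    (hK : ∀ x : 𝔭, UEA.ι (x : 𝔤) - algebraMap ℂ (UEA 𝔤) (φ x) ∈ K) :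
    whittakerMap K hK (whittakerVector φ) = Submodule.Quotient.mk 1 := by
  change K.mkQ ((1 : ℂ) • (1 : UEA 𝔤)) = _
  rw [one_smul]; rfl

end WhittakerMap

/-! ### Testing submodules generated by an ideal against a quotient of `U(𝔤)`. -/

section IdealAction

variable {𝔤 : Type} [LieRing 𝔤] [LieAlgebra ℂ 𝔤] {V : Type} [AddCommGroup V]
  [Module (UEA 𝔤) V]

/-- The image of `v` is the class of some `u`, so the image of `x v` is the class of `x u`. This is
why right multiples must be controlled. -/
theorem idealAction_le_ker (𝔞 : LieIdeal ℂ 𝔤) {K : Submodule (UEA 𝔤) (UEA 𝔤)}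
    (T : V →ₗ[UEA 𝔤] UEA 𝔤 ⧸ K) (h : ∀ x ∈ 𝔞, ∀ u : UEA 𝔤, UEA.ι x * u ∈ K) :
    idealAction 𝔞 V ≤ LinearMap.ker T := by
  rw [idealAction, Submodule.span_le]
  rintro _ ⟨x, hx, v, rfl⟩
  rw [SetLike.mem_coe, LinearMap.mem_ker, map_smul]
  obtain ⟨u, hu⟩ := K.mkQ_surjective (T v)
  rw [← hu, ← map_smul, Submodule.mkQ_apply, Submodule.Quotient.mk_eq_zero]
  exact h x hx u

theorem ne_top_of_le_ker {K : Submodule (UEA 𝔤) (UEA 𝔤)} (hK : (1 : UEA 𝔤) ∉ K)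
    (T : V →ₗ[UEA 𝔤] UEA 𝔤 ⧸ K) {v : V} (hv : T v = Submodule.Quotient.mk 1)
    {N : Submodule (UEA 𝔤) V} (hN : N ≤ LinearMap.ker T) : N ≠ ⊤ := by
  rintro rfl
  have h : T v = 0 := hN trivial
  rw [hv, Submodule.Quotient.mk_eq_zero] at h
  exact hK h

/-- The vector `x v` maps to the class of `x`, which is the nonzero class of 1. -/
theorem idealAction_ne_bot {𝔞 : LieIdeal ℂ 𝔤} {K : Submodule (UEA 𝔤) (UEA 𝔤)}
    (hK : (1 : UEA 𝔤) ∉ K) (T : V →ₗ[UEA 𝔤] UEA 𝔤 ⧸ K) {v : V}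
    (hv : T v = Submodule.Quotient.mk 1) {x : 𝔤} (hx : x ∈ 𝔞) (hxK : UEA.ι x - 1 ∈ K) :
    idealAction 𝔞 V ≠ ⊥ := by
  intro h
  have h1 : (UEA.ι x : UEA 𝔤) • v ∈ idealAction 𝔞 V := Submodule.subset_span ⟨x, hx, v, rfl⟩
  rw [h, Submodule.mem_bot] at h1
  have h2 : T ((UEA.ι x : UEA 𝔤) • v) = 0 := by rw [h1, map_zero]
  rw [map_smul, hv, ← Submodule.Quotient.mk_smul, Submodule.Quotient.mk_eq_zero, smul_eq_mul,
    mul_one] at h2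
  exact hK (by simpa using K.sub_mem h2 hxK)

end IdealAction

/-! ### Complementary subalgebras cut out by a partition of a basis. -/

section Basis

variable {𝔤 κ : Type} [LieRing 𝔤] [LieAlgebra ℂ 𝔤]

theorem one_notMem_characterIdeal (b : Module.Basis κ ℂ 𝔤) (S : Set κ) (χ : 𝔤 →ₗ[ℂ] ℂ)
    (h𝔭 : ∀ i ∈ S, ∀ j ∈ S, ⁅b i, b j⁆ ∈ Submodule.span ℂ (b '' S))
    (h𝔫 : ∀ i ∉ S, ∀ j ∉ S, ⁅b i, b j⁆ ∈ Submodule.span ℂ (b '' Sᶜ))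
    (hχ : ∀ i ∈ S, ∀ j ∈ S, χ ⁅b i, b j⁆ = 0) :
    (1 : UEA 𝔤) ∉ characterIdeal (Submodule.span ℂ (b '' S)) χ := by
  let 𝔭 : LieSubalgebra ℂ 𝔤 :=
    { Submodule.span ℂ (b '' S) with
      lie_mem' := lie_mem_span_of_generators (by
        rintro _ ⟨i, hi, rfl⟩ _ ⟨j, hj, rfl⟩; exact h𝔭 i hi j hj) }
  let 𝔫 : LieSubalgebra ℂ 𝔤 :=
    { Submodule.span ℂ (b '' Sᶜ) with
      lie_mem' := lie_mem_span_of_generators (by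
        rintro _ ⟨i, hi, rfl⟩ _ ⟨j, hj, rfl⟩; exact h𝔫 i hi j hj) }
  refine one_notMem_characterIdeal_of_isCompl 𝔭 𝔫 ⟨?_, ?_⟩ χ ?_
  · exact b.linearIndependent.disjoint_span_image disjoint_compl_right
  · rw [codisjoint_iff]
    change Submodule.span ℂ (b '' S) ⊔ Submodule.span ℂ (b '' Sᶜ) = ⊤
    rw [← Submodule.span_union, ← Set.image_union, Set.union_compl_self, Set.image_univ, b.span_eq]
  · intro x hx y hy
    refine lie_mem_span_of_generators (W := LinearMap.ker χ) ?_ hx hy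
    rintro _ ⟨i, hi, rfl⟩ _ ⟨j, hj, rfl⟩
    exact hχ i hi j hj

end Basis

/-! ### Subalgebras containing the positive part, and their characters -/

/-- An up-closed set of integers that contains all positive integers. -/
structure IsUpperPart (Q : ℤ → Prop) : Prop where
  mono : ∀ {m n : ℤ}, Q m → m ≤ n → Q n
  one : Q 1

theorem IsUpperPart.pos {Q : ℤ → Prop} (h : IsUpperPart Q) {m : ℤ} (hm : 1 ≤ m) : Q m :=
  h.mono h.one hm

namespace PGCA

/-- The basis `L_m, H_m, I_m, J_m` of `𝒢`. -/
def basis : Module.Basis PGCAGen ℂ PGCA := Finsupp.basisSingleOne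

theorem basis_apply (g : PGCAGen) : basis g = e g := by
  change (Finsupp.basisSingleOne : Module.Basis PGCAGen ℂ (PGCAGen →₀ ℂ)) g = Finsupp.single g 1
  simp

/-- Labels of the basis of a subalgebra containing `𝒢⁺`. -/
def UpperGen (p : ℤ) (Q R : ℤ → Prop) : PGCAGen → Prop
  | .L m => 1 ≤ m
  | .H m => p ≤ m
  | .I m => Q m
  | .J m => R m

/-- Values on the basis of an extension of `χ` from `𝒢⁺`. -/
def value (χ : PGCA →ₗ[ℂ] ℂ) (c i j : ℂ) : PGCAGen → ℂ
  | .L m => χ (L m)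
  | .H m => if m ≤ 0 then c else χ (H m)
  | .I m => if m ≤ 0 then i else χ (I m)
  | .J m => if m ≤ 0 then j else χ (J m)

/-- The left ideal defined by a character of a subalgebra containing `𝒢⁺`. -/
def leftIdeal (χ : PGCA →ₗ[ℂ] ℂ) (p : ℤ) (Q R : ℤ → Prop) (c i j : ℂ) :
    Submodule (UEA PGCA) (UEA PGCA) :=
  characterIdeal (Submodule.span ℂ (basis '' {g | UpperGen p Q R g})) (basis.constr ℂ (value χ c i j))

/-- `χ` vanishes on brackets of positive elements. -/
def IsCharOnPos (χ : PGCA →ₗ[ℂ] ℂ) : Prop := ∀ x ∈ pos, ∀ y ∈ pos, χ ⁅x, y⁆ = 0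

/-- Serves for closure of 𝔭, closure of its complement, and vanishing of a character on brackets.
The coefficients stay in the first two families because that vanishing may come from m = n or m = 0.
-/
theorem lie_e_mem {S : PGCAGen → Prop} {W : Submodule ℂ PGCA}
    (hLL : ∀ n m, S (.L n) → S (.L m) → ((m : ℂ) - n) • L (m + n) ∈ W)
    (hLH : ∀ n m, S (.L n) → S (.H m) → (m : ℂ) • H (m + n) ∈ W)
    (hLI : ∀ n m, S (.L n) → S (.I m) → I (m + n) ∈ W)
    (hLJ : ∀ n m, S (.L n) → S (.J m) → J (m + n) ∈ W)
    (hHI : ∀ n m, S (.H n) → S (.I m) → I (m + n) ∈ W)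
    (hHJ : ∀ n m, S (.H n) → S (.J m) → J (m + n) ∈ W)
    {g h : PGCAGen} (hg : S g) (hh : S h) : ⁅e g, e h⁆ ∈ W := by
  rw [lie_e]
  cases g <;> cases h <;> simp only [PGCAGen.bracket, single_eq]
  · exact hLL _ _ hg hh
  · exact hLH _ _ hg hh
  · exact W.smul_mem _ (hLI _ _ hg hh)
  · exact W.smul_mem _ (hLJ _ _ hg hh)
  · exact W.neg_mem (hLH _ _ hh hg)
  · exact W.zero_mem
  · exact W.smul_mem _ (hHI _ _ hg hh)
  · exact W.smul_mem _ (hHJ _ _ hg hh)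
  · exact W.neg_mem (W.smul_mem _ (hLI _ _ hh hg))
  · exact W.neg_mem (W.smul_mem _ (hHI _ _ hh hg))
  · exact W.zero_mem
  · exact W.zero_mem
  · exact W.neg_mem (W.smul_mem _ (hLJ _ _ hh hg))
  · exact W.neg_mem (W.smul_mem _ (hHJ _ _ hh hg))
  · exact W.zero_mem
  · exact W.zero_mem

/-- These basis vectors are nonzero multiples of brackets: [L_1, L_{m-1}] = (m-2)L_m, [L_1, H_{m-1}]
= (m-1)H_m, [H_1, I_{m-1}] = I_m, [H_1, J_{m-1}] = -J_m. -/
theorem IsCharOnPos.eq_zero {χ : PGCA →ₗ[ℂ] ℂ} (hχ : IsCharOnPos χ) {m : ℤ} :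
    (3 ≤ m → χ (L m) = 0) ∧ (2 ≤ m → χ (H m) = 0) ∧ (2 ≤ m → χ (I m) = 0) ∧
      (2 ≤ m → χ (J m) = 0) := by
  have h1 : ∀ k : ℤ, 1 ≤ k → L k ∈ pos ∧ H k ∈ pos ∧ I k ∈ pos ∧ J k ∈ pos := fun k hk =>
    ⟨Submodule.subset_span ⟨k, hk, by simp⟩, Submodule.subset_span ⟨k, hk, by simp⟩,
      Submodule.subset_span ⟨k, hk, by simp⟩, Submodule.subset_span ⟨k, hk, by simp⟩⟩
  have h0 := h1 1 le_rfl
  refine ⟨fun hm => ?_, fun hm => ?_, fun hm => ?_, fun hm => ?_⟩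
  · have h := hχ _ h0.1 _ (h1 (m - 1) (by omega)).1
    rw [lie_e] at h
    simp only [PGCAGen.bracket, single_eq, map_smul, sub_add_cancel, smul_eq_mul] at h
    refine (mul_eq_zero.mp h).resolve_left fun h' => ?_
    have h2 : (m : ℂ) = (2 : ℤ) := by push_cast at h' ⊢; linear_combination h'
    have := Int.cast_injective h2
    omega
  · have h := hχ _ h0.1 _ (h1 (m - 1) (by omega)).2.1
    rw [lie_e] at h
    simp only [PGCAGen.bracket, single_eq, map_smul, sub_add_cancel, smul_eq_mul] at h
    refine (mul_eq_zero.mp h).resolve_left fun h' => ?_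
    have := Int.cast_eq_zero.mp h'
    omega
  · have h := hχ _ h0.2.1 _ (h1 (m - 1) (by omega)).2.2.1
    rw [lie_e] at h
    simpa only [PGCAGen.bracket, single_eq, map_smul, sub_add_cancel, one_smul] using h
  · have h := hχ _ h0.2.1 _ (h1 (m - 1) (by omega)).2.2.2
    rw [lie_e] at h
    simpa only [PGCAGen.bracket, single_eq, map_smul, sub_add_cancel, smul_eq_mul,
      neg_mul, one_mul, neg_eq_zero] using h

end PGCA

/-- The condition that the values `i, j` define a character of the subalgebra of type `p, Q, R`. -/
structure IsUpperChar (χ : PGCA →ₗ[ℂ] ℂ) (p : ℤ) (Q R : ℤ → Prop) (i j : ℂ) : Prop where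
  char : PGCA.IsCharOnPos χ
  nonneg : 0 ≤ p
  le_one : p ≤ 1
  upperI : IsUpperPart Q
  upperJ : IsUpperPart R
  valueI : ∀ m n : ℤ, Q m → p ≤ n → (if m + n ≤ 0 then i else χ (PGCA.I (m + n))) = 0
  valueJ : ∀ m n : ℤ, R m → p ≤ n → (if m + n ≤ 0 then j else χ (PGCA.J (m + n))) = 0

namespace PGCA

variable {χ : PGCA →ₗ[ℂ] ℂ} {p : ℤ} {Q R : ℤ → Prop} {c i j : ℂ}

theorem constr_e (f : PGCAGen → ℂ) (g : PGCAGen) : basis.constr ℂ f (e g) = f g := by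
  rw [← basis_apply, Module.Basis.constr_basis]

/-- Indices of `L` and `H` are nonnegative in 𝔭 and nonpositive in the complement, so brackets with
them shift the index of an `I` or `J` up or down respectively. Up-closedness of `Q` and `R` then
makes both spans subalgebras. -/
theorem one_notMem_leftIdeal (h : IsUpperChar χ p Q R i j) (c : ℂ) :
    1 ∉ leftIdeal χ p Q R c i j := by
  obtain ⟨hχ, hp0, hp1, hQ, hR, hI, hJ⟩ := h
  have hs : ∀ (S : PGCAGen → Prop) k, S k → e k ∈ Submodule.span ℂ (basis '' {g | S g}) :=
    fun S k hk => Submodule.subset_span ⟨k, hk, basis_apply k⟩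
  refine one_notMem_characterIdeal basis _ _ ?_ ?_ ?_
  · intro g hg g' hg'
    rw [basis_apply, basis_apply]
    refine lie_e_mem (S := UpperGen p Q R) ?_ ?_ ?_ ?_ ?_ ?_ hg hg' <;> intro n m hn hm <;>
      simp only [UpperGen] at hn hm <;> try refine Submodule.smul_mem _ _ ?_
    all_goals refine hs _ _ ?_
    all_goals simp only [UpperGen]
    · omega
    · omega
    · exact hQ.mono hm (by omega)
    · exact hR.mono hm (by omega)
    · exact hQ.mono hm (by omega)
    · exact hR.mono hm (by omega)
  · intro g hg g' hg'
    rw [basis_apply, basis_apply]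
    refine lie_e_mem (S := fun g => ¬ UpperGen p Q R g) ?_ ?_ ?_ ?_ ?_ ?_ hg hg' <;>
      intro n m hn hm <;>
      simp only [UpperGen] at hn hm <;> try refine Submodule.smul_mem _ _ ?_
    all_goals refine hs (fun g => ¬ UpperGen p Q R g) _ ?_
    all_goals simp only [UpperGen]
    · omega
    · omega
    · exact fun h => hm (hQ.mono h (by omega))
    · exact fun h => hm (hR.mono h (by omega))
    · exact fun h => hm (hQ.mono h (by omega))
    · exact fun h => hm (hR.mono h (by omega))
  · intro g hg g' hg'
    rw [basis_apply, basis_apply, ← LinearMap.mem_ker]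
    refine lie_e_mem (S := UpperGen p Q R) ?_ ?_ ?_ ?_ ?_ ?_ hg hg' <;> intro n m hn hm <;>
      simp only [UpperGen] at hn hm <;>
      simp only [LinearMap.mem_ker, map_smul, constr_e, value, smul_eq_mul]
    · obtain h | h := eq_or_ne m n
      · rw [h, sub_self, zero_mul]
      · rw [hχ.eq_zero.1 (by omega), mul_zero]
    -- Since [L_n, H_0] = 0, the vector `H_0` is never produced by a bracket in 𝔭 and its value `c`
    -- is free.
    · obtain h | h := eq_or_ne m 0
      · rw [h, Int.cast_zero, zero_mul]
      · rw [if_neg (by omega), hχ.eq_zero.2.1 (by omega), mul_zero]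
    · exact hI m n hm (by omega)
    · exact hJ m n hm (by omega)
    · exact hI m n hm hn
    · exact hJ m n hm hn

theorem ι_sub_mem_leftIdeal {g : PGCAGen} (hg : UpperGen p Q R g) :
    UEA.ι (e g) - algebraMap ℂ (UEA PGCA) (value χ c i j g) ∈ leftIdeal χ p Q R c i j := by
  rw [← constr_e (value χ c i j)]
  exact ι_sub_mem_characterIdeal (Submodule.subset_span ⟨g, hg, basis_apply g⟩)

/-- Here ℐ lies in 𝔭 and the character vanishes on it, so `ι_sub_mul_mem_characterIdeal` applies
with 𝔟 = ℐ. -/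
theorem ι_mul_mem_leftIdeal_I (hQ : ∀ m, Q m) (hI : ∀ m, value χ c i j (.I m) = 0) {x : PGCA}
    (hx : x ∈ idealI) (u : UEA PGCA) : UEA.ι x * u ∈ leftIdeal χ p Q R c i j := by
  have h0 : ∀ x ∈ idealI, basis.constr ℂ (value χ c i j) x = 0 := by
    have : idealI.toSubmodule ≤ LinearMap.ker (basis.constr ℂ (value χ c i j)) := by
      refine Submodule.span_le.mpr ?_
      rintro _ ⟨m, rfl⟩
      rw [SetLike.mem_coe, LinearMap.mem_ker, constr_e, hI]
    exact this
  have h1 := ι_sub_mul_mem_characterIdeal (𝔟 := idealI.toSubmodule)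
    (𝔭 := Submodule.span ℂ (basis '' {g | UpperGen p Q R g}))
    (χ := basis.constr ℂ (value χ c i j)) (Submodule.span_mono (by
      rintro _ ⟨m, rfl⟩; exact ⟨.I m, hQ m, basis_apply _⟩))
    (fun y x hx => ⟨idealI.lie_mem hx, h0 _ (idealI.lie_mem hx)⟩) hx u
  rwa [h0 x hx, map_zero, sub_zero] at h1

theorem ι_mul_mem_leftIdeal_J (hR : ∀ m, R m) (hJ : ∀ m, value χ c i j (.J m) = 0) {x : PGCA}
    (hx : x ∈ idealJ) (u : UEA PGCA) : UEA.ι x * u ∈ leftIdeal χ p Q R c i j := by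
  have h0 : ∀ x ∈ idealJ, basis.constr ℂ (value χ c i j) x = 0 := by
    have : idealJ.toSubmodule ≤ LinearMap.ker (basis.constr ℂ (value χ c i j)) := by
      refine Submodule.span_le.mpr ?_
      rintro _ ⟨m, rfl⟩
      rw [SetLike.mem_coe, LinearMap.mem_ker, constr_e, hJ]
    exact this
  have h1 := ι_sub_mul_mem_characterIdeal (𝔟 := idealJ.toSubmodule)
    (𝔭 := Submodule.span ℂ (basis '' {g | UpperGen p Q R g}))
    (χ := basis.constr ℂ (value χ c i j)) (Submodule.span_mono (by
      rintro _ ⟨m, rfl⟩; exact ⟨.J m, hR m, basis_apply _⟩))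
    (fun y x hx => ⟨idealJ.lie_mem hx, h0 _ (idealJ.lie_mem hx)⟩) hx u
  rwa [h0 x hx, map_zero, sub_zero] at h1

theorem ι_sub_mem_leftIdeal_of_mem_pos (h : IsUpperChar χ p Q R i j)
    {φ : LieAlgebra.LieCharacter ℂ pos} (hφ : ∀ x : pos, φ x = χ x) (x : pos) :
    UEA.ι (x : PGCA) - algebraMap ℂ (UEA PGCA) (φ x) ∈ leftIdeal χ p Q R c i j := by
  have h1 : pos.toSubmodule ≤ Submodule.span ℂ (basis '' {g | UpperGen p Q R g}) ⊓
      LinearMap.eqLocus (basis.constr ℂ (value χ c i j)) χ := by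
    refine Submodule.span_le.mpr ?_
    rintro x ⟨m, hm, rfl | rfl | rfl | rfl⟩ <;>
      refine ⟨Submodule.subset_span ⟨_, ?_, basis_apply _⟩, ?_⟩
    · exact hm
    · exact constr_e _ _
    · exact h.le_one.trans hm
    · exact (constr_e _ _).trans (if_neg (by omega))
    · exact h.upperI.pos hm
    · exact (constr_e _ _).trans (if_neg (by omega))
    · exact h.upperJ.pos hm
    · exact (constr_e _ _).trans (if_neg (by omega))
  rw [hφ, ← LinearMap.mem_eqLocus.mp (h1 x.2).2]
  exact ι_sub_mem_characterIdeal (h1 x.2).1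

theorem exists_map_leftIdeal (h : IsUpperChar χ p Q R i j)
    {φ : LieAlgebra.LieCharacter ℂ pos} (hφ : ∀ x : pos, φ x = χ x) (c : ℂ) :
    ∃ (T : GenericWhittaker φ →ₗ[UEA PGCA] UEA PGCA ⧸ leftIdeal χ p Q R c i j)
      (v : GenericWhittaker φ), T v = Submodule.Quotient.mk 1 :=
  ⟨whittakerMap _ (ι_sub_mem_leftIdeal_of_mem_pos h hφ), _, whittakerMap_vector _ _⟩

end PGCA

/-! ### The extension: the same subalgebras enlarged by the centre. -/

namespace PGCAExt

/-- The basis `L_m, H_m, I_m, J_m, C_s` of `𝒢̃`. -/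
def basis : Module.Basis PGCAExtGen ℂ PGCAExt := Finsupp.basisSingleOne

theorem basis_apply (g : PGCAExtGen) : basis g = e g := by
  change (Finsupp.basisSingleOne : Module.Basis PGCAExtGen ℂ (PGCAExtGen →₀ ℂ)) g =
    Finsupp.single g 1
  simp

/-- Labels of the basis of a subalgebra containing `𝒢̃⁺`. -/
def UpperGen (p : ℤ) (Q R : ℤ → Prop) : PGCAExtGen → Prop
  | .L m => 1 ≤ m
  | .H m => p ≤ m
  | .I m => Q m
  | .J m => R m
  | .C _ => True

/-- Values on the basis of an extension of `χ` from `𝒢̃⁺`. -/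
def value (χ : PGCA →ₗ[ℂ] ℂ) (ξ : Fin 3 → ℂ) (c i j : ℂ) : PGCAExtGen → ℂ
  | .L m => χ (PGCA.L m)
  | .H m => if m ≤ 0 then c else χ (PGCA.H m)
  | .I m => if m ≤ 0 then i else χ (PGCA.I m)
  | .J m => if m ≤ 0 then j else χ (PGCA.J m)
  | .C s => ξ s

/-- The cocycle terms carry factors n³, n², n at m + n = 0. By `hz` they occur only with n = 0,
hence vanish; in particular the complement, which omits the centre, stays closed. -/
theorem lie_e_mem {S : PGCAExtGen → Prop} {W : Submodule ℂ PGCAExt}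
    (hLL : ∀ n m, S (.L n) → S (.L m) → ((m : ℂ) - n) • L (m + n) ∈ W)
    (hLH : ∀ n m, S (.L n) → S (.H m) → (m : ℂ) • H (m + n) ∈ W)
    (hLI : ∀ n m, S (.L n) → S (.I m) → I (m + n) ∈ W)
    (hLJ : ∀ n m, S (.L n) → S (.J m) → J (m + n) ∈ W)
    (hHI : ∀ n m, S (.H n) → S (.I m) → I (m + n) ∈ W)
    (hHJ : ∀ n m, S (.H n) → S (.J m) → J (m + n) ∈ W)
    (hz : ∀ n m, S (.L n) ∧ S (.L m) ∨ S (.L n) ∧ S (.H m) ∨ S (.H n) ∧ S (.H m) →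
      m + n = 0 → n = 0)
    {g h : PGCAExtGen} (hg : S g) (hh : S h) : ⁅e g, e h⁆ ∈ W := by
  have key : ∀ (n m : ℤ) (s : Fin 3) (k : ℕ), k ≠ 0 →
      S (.L n) ∧ S (.L m) ∨ S (.L n) ∧ S (.H m) ∨ S (.H n) ∧ S (.H m) →
      (if m + n = 0 then (n : ℂ) ^ k else 0) • C s ∈ W := by
    intro n m s k hk h
    split_ifs with h0
    · rw [hz n m h h0, Int.cast_zero, zero_pow hk, zero_smul]; exact W.zero_mem
    · rw [zero_smul]; exact W.zero_mem
  have keyLL := fun n m h => key n m 0 3 (by norm_num) (Or.inl h)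
  have keyLH := fun n m h => key n m 1 2 (by norm_num) (Or.inr (Or.inl h))
  have keyHH := fun n m h => key n m 2 1 (by norm_num) (Or.inr (Or.inr h))
  simp only [pow_one] at keyHH
  rw [lie_e]
  cases g <;> cases h <;> simp only [PGCAExtGen.bracket, single_eq]
  · exact W.add_mem (hLL _ _ hg hh) (keyLL _ _ ⟨hg, hh⟩)
  · exact W.add_mem (hLH _ _ hg hh) (keyLH _ _ ⟨hg, hh⟩)
  · exact W.smul_mem _ (hLI _ _ hg hh)
  · exact W.smul_mem _ (hLJ _ _ hg hh)
  · exact W.zero_mem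
  · exact W.neg_mem (W.add_mem (hLH _ _ hh hg) (keyLH _ _ ⟨hh, hg⟩))
  · exact keyHH _ _ ⟨hg, hh⟩
  · exact W.smul_mem _ (hHI _ _ hg hh)
  · exact W.smul_mem _ (hHJ _ _ hg hh)
  · exact W.zero_mem
  · exact W.neg_mem (W.smul_mem _ (hLI _ _ hh hg))
  · exact W.neg_mem (W.smul_mem _ (hHI _ _ hh hg))
  · exact W.zero_mem
  · exact W.zero_mem
  · exact W.zero_mem
  · exact W.neg_mem (W.smul_mem _ (hLJ _ _ hh hg))
  · exact W.neg_mem (W.smul_mem _ (hHJ _ _ hh hg))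
  · exact W.zero_mem
  · exact W.zero_mem
  · exact W.zero_mem
  all_goals exact W.zero_mem

/-- The left ideal defined by a character of a subalgebra containing `𝒢̃⁺`. -/
def leftIdeal (χ : PGCA →ₗ[ℂ] ℂ) (p : ℤ) (Q R : ℤ → Prop) (ξ : Fin 3 → ℂ) (c i j : ℂ) :
    Submodule (UEA PGCAExt) (UEA PGCAExt) :=
  characterIdeal (Submodule.span ℂ (basis '' {g | UpperGen p Q R g}))
    (basis.constr ℂ (value χ ξ c i j))

variable {χ : PGCA →ₗ[ℂ] ℂ} {p : ℤ} {Q R : ℤ → Prop} {ξ : Fin 3 → ℂ} {c i j : ℂ}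

theorem constr_e (f : PGCAExtGen → ℂ) (g : PGCAExtGen) : basis.constr ℂ f (e g) = f g := by
  rw [← basis_apply, Module.Basis.constr_basis]

theorem one_notMem_leftIdeal (h : IsUpperChar χ p Q R i j) (ξ : Fin 3 → ℂ)
    (c : ℂ) : 1 ∉ leftIdeal χ p Q R ξ c i j := by
  obtain ⟨hχ, hp0, hp1, hQ, hR, hI, hJ⟩ := h
  have hs : ∀ (S : PGCAExtGen → Prop) k, S k → e k ∈ Submodule.span ℂ (basis '' {g | S g}) :=
    fun S k hk => Submodule.subset_span ⟨k, hk, basis_apply k⟩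
  refine one_notMem_characterIdeal basis _ _ ?_ ?_ ?_
  · intro g hg g' hg'
    rw [basis_apply, basis_apply]
    refine lie_e_mem (S := UpperGen p Q R) ?_ ?_ ?_ ?_ ?_ ?_ (fun n m h => by
      simp only [UpperGen] at h; omega) hg hg' <;> intro n m hn hm <;>
      simp only [UpperGen] at hn hm <;> try refine Submodule.smul_mem _ _ ?_
    all_goals refine hs _ _ ?_
    all_goals simp only [UpperGen]
    · omega
    · omega
    · exact hQ.mono hm (by omega)
    · exact hR.mono hm (by omega)
    · exact hQ.mono hm (by omega)
    · exact hR.mono hm (by omega)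
  · intro g hg g' hg'
    rw [basis_apply, basis_apply]
    refine lie_e_mem (S := fun g => ¬ UpperGen p Q R g) ?_ ?_ ?_ ?_ ?_ ?_ (fun n m h => by
      simp only [UpperGen] at h; omega) hg hg' <;>
      intro n m hn hm <;>
      simp only [UpperGen] at hn hm <;> try refine Submodule.smul_mem _ _ ?_
    all_goals refine hs (fun g => ¬ UpperGen p Q R g) _ ?_
    all_goals simp only [UpperGen]
    · omega
    · omega
    · exact fun h => hm (hQ.mono h (by omega))
    · exact fun h => hm (hR.mono h (by omega))
    · exact fun h => hm (hQ.mono h (by omega))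
    · exact fun h => hm (hR.mono h (by omega))
  · intro g hg g' hg'
    rw [basis_apply, basis_apply, ← LinearMap.mem_ker]
    refine lie_e_mem (S := UpperGen p Q R) ?_ ?_ ?_ ?_ ?_ ?_ (fun n m h => by
      simp only [UpperGen] at h; omega) hg hg' <;> intro n m hn hm <;>
      simp only [UpperGen] at hn hm <;>
      simp only [LinearMap.mem_ker, map_smul, constr_e, value, smul_eq_mul]
    · obtain h | h := eq_or_ne m n
      · rw [h, sub_self, zero_mul]
      · rw [hχ.eq_zero.1 (by omega), mul_zero]
    · obtain h | h := eq_or_ne m 0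
      · rw [h, Int.cast_zero, zero_mul]
      · rw [if_neg (by omega), hχ.eq_zero.2.1 (by omega), mul_zero]
    · exact hI m n hm (by omega)
    · exact hJ m n hm (by omega)
    · exact hI m n hm hn
    · exact hJ m n hm hn

theorem ι_sub_mem_leftIdeal {g : PGCAExtGen} (hg : UpperGen p Q R g) :
    UEA.ι (e g) - algebraMap ℂ (UEA PGCAExt) (value χ ξ c i j g) ∈ leftIdeal χ p Q R ξ c i j := by
  rw [← constr_e (value χ ξ c i j)]
  exact ι_sub_mem_characterIdeal (Submodule.subset_span ⟨g, hg, basis_apply g⟩)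

theorem ι_mul_mem_leftIdeal_I (hQ : ∀ m, Q m) (hI : ∀ m, value χ ξ c i j (.I m) = 0) {x : PGCAExt}
    (hx : x ∈ idealI) (u : UEA PGCAExt) : UEA.ι x * u ∈ leftIdeal χ p Q R ξ c i j := by
  have h0 : ∀ x ∈ idealI, basis.constr ℂ (value χ ξ c i j) x = 0 := by
    have : idealI.toSubmodule ≤ LinearMap.ker (basis.constr ℂ (value χ ξ c i j)) := by
      refine Submodule.span_le.mpr ?_
      rintro _ ⟨m, rfl⟩
      rw [SetLike.mem_coe, LinearMap.mem_ker, constr_e, hI]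
    exact this
  have h1 := ι_sub_mul_mem_characterIdeal (𝔟 := idealI.toSubmodule)
    (𝔭 := Submodule.span ℂ (basis '' {g | UpperGen p Q R g}))
    (χ := basis.constr ℂ (value χ ξ c i j)) (Submodule.span_mono (by
      rintro _ ⟨m, rfl⟩; exact ⟨.I m, hQ m, basis_apply _⟩))
    (fun y x hx => ⟨idealI.lie_mem hx, h0 _ (idealI.lie_mem hx)⟩) hx u
  rwa [h0 x hx, map_zero, sub_zero] at h1

theorem ι_mul_mem_leftIdeal_J (hR : ∀ m, R m) (hJ : ∀ m, value χ ξ c i j (.J m) = 0) {x : PGCAExt}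
    (hx : x ∈ idealJ) (u : UEA PGCAExt) : UEA.ι x * u ∈ leftIdeal χ p Q R ξ c i j := by
  have h0 : ∀ x ∈ idealJ, basis.constr ℂ (value χ ξ c i j) x = 0 := by
    have : idealJ.toSubmodule ≤ LinearMap.ker (basis.constr ℂ (value χ ξ c i j)) := by
      refine Submodule.span_le.mpr ?_
      rintro _ ⟨m, rfl⟩
      rw [SetLike.mem_coe, LinearMap.mem_ker, constr_e, hJ]
    exact this
  have h1 := ι_sub_mul_mem_characterIdeal (𝔟 := idealJ.toSubmodule)
    (𝔭 := Submodule.span ℂ (basis '' {g | UpperGen p Q R g}))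
    (χ := basis.constr ℂ (value χ ξ c i j)) (Submodule.span_mono (by
      rintro _ ⟨m, rfl⟩; exact ⟨.J m, hR m, basis_apply _⟩))
    (fun y x hx => ⟨idealJ.lie_mem hx, h0 _ (idealJ.lie_mem hx)⟩) hx u
  rwa [h0 x hx, map_zero, sub_zero] at h1

/-- The line through `C_s` is an ideal contained in 𝔭, and all brackets with it are zero. -/
theorem ι_sub_mul_mem_leftIdeal_C (s : Fin 3) (u : UEA PGCAExt) :
    (UEA.ι (C s) - algebraMap ℂ (UEA PGCAExt) (ξ s)) * u ∈ leftIdeal χ p Q R ξ c i j := by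
  have h0 : ∀ y : PGCAExt, ∀ x ∈ Submodule.span ℂ {C s}, ⁅y, x⁆ = 0 := by
    intro y x hx
    refine (Submodule.mem_bot ℂ).mp (lie_mem_span_of_generators (W := ⊥) ?_
      (show y ∈ Submodule.span ℂ (Set.range e) from span_range_e ▸ Submodule.mem_top) hx)
    rintro _ ⟨g, rfl⟩ _ rfl
    rw [lie_e]
    cases g <;> exact Submodule.zero_mem _
  have h1 := ι_sub_mul_mem_characterIdeal (𝔟 := Submodule.span ℂ {C s})
    (𝔭 := Submodule.span ℂ (basis '' {g | UpperGen p Q R g}))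
    (χ := basis.constr ℂ (value χ ξ c i j)) (Submodule.span_mono (by
      rintro _ rfl; exact ⟨.C s, trivial, basis_apply _⟩))
    (fun y x hx => by rw [h0 y x hx]; exact ⟨Submodule.zero_mem _, map_zero _⟩)
    (Submodule.mem_span_singleton_self (C s)) u
  rwa [constr_e] at h1

theorem ι_sub_mem_leftIdeal_of_mem_pos (h : IsUpperChar χ p Q R i j)
    {φ : LieAlgebra.LieCharacter ℂ PGCA.pos} (hφ : ∀ x : PGCA.pos, φ x = χ x) (x : pos) :
    UEA.ι (x : PGCAExt) - algebraMap ℂ (UEA PGCAExt) (extendChar φ x) ∈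
      leftIdeal χ p Q R ξ c i j := by
  have h1 : pos.toSubmodule ≤ Submodule.span ℂ (basis '' {g | UpperGen p Q R g}) ⊓
      LinearMap.eqLocus (basis.constr ℂ (value χ ξ c i j))
        (χ.comp (proj : PGCAExt →ₗ[ℂ] PGCA)) := by
    have h2 : ∀ g, (χ.comp (proj : PGCAExt →ₗ[ℂ] PGCA)) (e g) = χ (projGen g) := fun g =>
      congrArg χ (proj_e g)
    refine Submodule.span_le.mpr ?_
    rintro x ⟨m, hm, rfl | rfl | rfl | rfl⟩ <;>
      refine ⟨Submodule.subset_span ⟨_, ?_, basis_apply _⟩, ?_⟩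
    · exact hm
    · exact (constr_e _ _).trans (h2 (.L m)).symm
    · exact h.le_one.trans hm
    · exact ((constr_e _ _).trans (if_neg (by omega))).trans (h2 (.H m)).symm
    · exact h.upperI.pos hm
    · exact ((constr_e _ _).trans (if_neg (by omega))).trans (h2 (.I m)).symm
    · exact h.upperJ.pos hm
    · exact ((constr_e _ _).trans (if_neg (by omega))).trans (h2 (.J m)).symm
  have h3 : extendChar φ x = χ (proj x) := hφ ⟨proj x, proj_mem_pos x.2⟩
  have h4 : basis.constr ℂ (value χ ξ c i j) x = χ (proj x) := (h1 x.2).2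
  rw [h3, ← h4]
  exact ι_sub_mem_characterIdeal (h1 x.2).1

theorem exists_map_leftIdeal (h : IsUpperChar χ p Q R i j)
    {φ : LieAlgebra.LieCharacter ℂ PGCA.pos} (hφ : ∀ x : PGCA.pos, φ x = χ x)
    (ξ : Fin 3 → ℂ) (c : ℂ) :
    ∃ (T : GenericWhittaker φ ξ →ₗ[UEA PGCAExt] UEA PGCAExt ⧸ leftIdeal χ p Q R ξ c i j)
      (v : GenericWhittaker φ ξ), T v = Submodule.Quotient.mk 1 := by
  let K := leftIdeal χ p Q R ξ c i j
  let T : MTilde φ →ₗ[UEA PGCAExt] UEA PGCAExt ⧸ K :=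
    whittakerMap K (ι_sub_mem_leftIdeal_of_mem_pos h hφ)
  -- Each `C_s - ξ_s` acts by zero on the target, so the map descends to the quotient at level ξ.
  have hT : centralRelations φ ξ ≤ LinearMap.ker T := by
    rw [centralRelations, Submodule.span_le]
    rintro _ ⟨s, v, rfl⟩
    rw [SetLike.mem_coe, LinearMap.mem_ker, map_smul]
    obtain ⟨u, hu⟩ := K.mkQ_surjective (T v)
    rw [← hu, ← map_smul, Submodule.mkQ_apply, Submodule.Quotient.mk_eq_zero]
    exact ι_sub_mul_mem_leftIdeal_C s u
  exact ⟨(centralRelations φ ξ).liftQ T hT, Submodule.Quotient.mk (whittakerVector _),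
    whittakerMap_vector K (ι_sub_mem_leftIdeal_of_mem_pos h hφ)⟩

/-! ### The submodule `Ω̃` -/

/-- `H_0` is central modulo ℐ ⊕ 𝒥: it commutes with every `L_m` and `H_m`, the cocycle terms being
supported at m = 0 with coefficient zero there. -/
theorem lie_H_zero_mem (x : PGCAExt) : ⁅x, H 0⁆ ∈ idealI ⊔ idealJ := by
  have hx : x ∈ Submodule.span ℂ (Set.range e) := span_range_e ▸ Submodule.mem_top
  refine lie_mem_span_of_generators (W := (idealI ⊔ idealJ).toSubmodule) ?_ hx
    (Submodule.mem_span_singleton_self (H 0))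
  rintro _ ⟨g, rfl⟩ _ rfl
  have hI : ∀ m, I m ∈ idealI ⊔ idealJ := fun m =>
    (le_sup_left : idealI ≤ idealI ⊔ idealJ) (Submodule.subset_span ⟨m, rfl⟩)
  have hJ : ∀ m, J m ∈ idealI ⊔ idealJ := fun m =>
    (le_sup_right : idealJ ≤ idealI ⊔ idealJ) (Submodule.subset_span ⟨m, rfl⟩)
  have hC : ∀ (m : ℤ) (k : ℕ), k ≠ 0 → ∀ s,
      (if 0 + m = 0 then (m : ℂ) ^ k else 0) • C s ∈ idealI ⊔ idealJ := by
    intro m k hk s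
    split_ifs with h0
    · rw [show m = 0 by omega, Int.cast_zero, zero_pow hk, zero_smul]
      exact Submodule.zero_mem _
    · rw [zero_smul]; exact Submodule.zero_mem _
  have hC1 := fun m => hC m 1 one_ne_zero
  simp only [pow_one] at hC1
  have hH : ∀ m : ℤ, ((0 : ℤ) : ℂ) • H (0 + m) ∈ idealI ⊔ idealJ := by
    intro m
    rw [Int.cast_zero, zero_smul]; exact Submodule.zero_mem _
  rw [lie_e]
  cases g <;> rename_i m <;> simp only [PGCAExtGen.bracket, single_eq]
  · exact Submodule.add_mem _ (hH m) (hC m 2 two_ne_zero 1)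
  · exact hC1 m 2
  · exact Submodule.neg_mem _ (Submodule.smul_mem _ _ (hI _))
  · exact Submodule.neg_mem _ (Submodule.smul_mem _ _ (hJ _))
  · exact Submodule.zero_mem _

variable (φ : LieAlgebra.LieCharacter ℂ PGCA.pos)

theorem smul_mem_OmegaTilde (ξ : Fin 3 → ℂ) (c : ℂ) (u : UEA PGCAExt)
    {v : GenericWhittaker φ ξ} (hv : v ∈ OmegaTilde φ ξ c) : u • v ∈ OmegaTilde φ ξ c := by
  refine UEA.smul_mem_of_ι_smul_mem _ ?_ u hv
  intro x v hv
  obtain ⟨a, ha, _, ⟨w, rfl⟩, rfl⟩ := Submodule.mem_sup.mp hv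
  rw [smul_add]
  refine Submodule.add_mem _ (Submodule.mem_sup_left (Submodule.smul_mem
    (idealAction (idealI ⊔ idealJ) (GenericWhittaker φ ξ)) _ ha)) ?_
  -- Moving `x` across `H_0 - c` costs only [x, H_0], which is absorbed by the summand of ℐ ⊕ 𝒥.
  have h1 : (UEA.ι x : UEA PGCAExt) * (UEA.ι (H 0) - algebraMap ℂ (UEA PGCAExt) c) =
      UEA.ι ⁅x, H 0⁆ + (UEA.ι (H 0) - algebraMap ℂ (UEA PGCAExt) c) * UEA.ι x := by
    rw [UEA.ι_lie, mul_sub, sub_mul, Algebra.commutes]; abel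
  rw [Algebra.lsmul_apply, ← mul_smul, h1, add_smul, mul_smul]
  exact Submodule.add_mem _
    (Submodule.mem_sup_left (Submodule.subset_span ⟨_, lie_H_zero_mem x, w, rfl⟩))
    (Submodule.mem_sup_right ⟨(UEA.ι x : UEA PGCAExt) • w, rfl⟩)

/-- `Ω̃_{φ,ξ}` as a submodule over `U(𝒢̃)`. -/
def OmegaTildeSubmodule (ξ : Fin 3 → ℂ) (c : ℂ) :
    Submodule (UEA PGCAExt) (GenericWhittaker φ ξ) :=
  { OmegaTilde φ ξ c with smul_mem' := fun u _ hv => smul_mem_OmegaTilde φ ξ c u hv }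

theorem ι_mul_mem_leftIdeal_sup (hQ : ∀ m, Q m) (hR : ∀ m, R m)
    (hI : ∀ m, value χ ξ c i j (.I m) = 0) (hJ : ∀ m, value χ ξ c i j (.J m) = 0) {x : PGCAExt}
    (hx : x ∈ idealI ⊔ idealJ) (u : UEA PGCAExt) : UEA.ι x * u ∈ leftIdeal χ p Q R ξ c i j := by
  obtain ⟨y, hy, z, hz, rfl⟩ := LieSubmodule.mem_sup _ _ _ |>.mp hx
  rw [UEA.ι, map_add, add_mul]
  exact Submodule.add_mem _ (ι_mul_mem_leftIdeal_I hQ hI hy u) (ι_mul_mem_leftIdeal_J hR hJ hz u)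

/-- The line through `H_0` is not an ideal, so the correction [y, H_0]v is handled separately: it
lies in the left ideal because ℐ ⊕ 𝒥 acts by zero on the quotient. -/
theorem ι_H_sub_mul_mem_leftIdeal (hp : p ≤ 0) (hQ : ∀ m, Q m) (hR : ∀ m, R m)
    (hI : ∀ m, value χ ξ c i j (.I m) = 0) (hJ : ∀ m, value χ ξ c i j (.J m) = 0)
    (u : UEA PGCAExt) : (UEA.ι (H 0) - algebraMap ℂ (UEA PGCAExt) c) * u ∈
      leftIdeal χ p Q R ξ c i j := by
  let K := leftIdeal χ p Q R ξ c i j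
  change u ∈ (K.restrictScalars ℂ).comap
    (LinearMap.mulLeft ℂ (UEA.ι (H 0) - algebraMap ℂ (UEA PGCAExt) c))
  refine UEA.left_induction _ ?_ ?_ u
  · have h := ι_sub_mem_leftIdeal (χ := χ) (Q := Q) (R := R) (ξ := ξ) (c := c) (i := i) (j := j)
      (g := .H 0) hp
    simpa [value] using h
  · intro y v hv
    change (UEA.ι (H 0) - algebraMap ℂ (UEA PGCAExt) c) * v ∈ K at hv
    change (UEA.ι (H 0) - algebraMap ℂ (UEA PGCAExt) c) * (UEA.ι y * v) ∈ K
    have h1 := K.smul_mem (UEA.ι y) hv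
    have h2 : UEA.ι ⁅y, H 0⁆ * v ∈ K := ι_mul_mem_leftIdeal_sup hQ hR hI hJ (lie_H_zero_mem y) v
    have h3 := K.sub_mem h1 h2
    convert h3 using 1
    rw [smul_eq_mul, UEA.ι_lie]
    simp only [sub_mul, mul_sub, ← mul_assoc, ← Algebra.commutes c (UEA.ι y)]
    abel

theorem OmegaTildeSubmodule_le_ker {φ : LieAlgebra.LieCharacter ℂ PGCA.pos}
    (hp : p ≤ 0) (hQ : ∀ m, Q m) (hR : ∀ m, R m)
    (hI : ∀ m, value χ ξ c i j (.I m) = 0) (hJ : ∀ m, value χ ξ c i j (.J m) = 0)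
    (T : GenericWhittaker φ ξ →ₗ[UEA PGCAExt] UEA PGCAExt ⧸ leftIdeal χ p Q R ξ c i j) :
    OmegaTildeSubmodule φ ξ c ≤ LinearMap.ker T := by
  intro v hv
  obtain ⟨a, ha, _, ⟨w, rfl⟩, rfl⟩ := Submodule.mem_sup.mp
    (show v ∈ OmegaTilde φ ξ c from hv)
  refine Submodule.add_mem _ (idealAction_le_ker _ T
    (fun x hx u => ι_mul_mem_leftIdeal_sup hQ hR hI hJ hx u) ha) ?_
  rw [LinearMap.mem_ker, Algebra.lsmul_apply, map_smul]
  obtain ⟨u, hu⟩ := (leftIdeal χ p Q R ξ c i j).mkQ_surjective (T w)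
  rw [← hu, ← map_smul, Submodule.mkQ_apply, Submodule.Quotient.mk_eq_zero]
  exact ι_H_sub_mul_mem_leftIdeal hp hQ hR hI hJ u

end PGCAExt

/-! ### The characters used as tests. -/

theorem exists_functional (φ : LieAlgebra.LieCharacter ℂ PGCA.pos) :
    ∃ χ : PGCA →ₗ[ℂ] ℂ, PGCA.IsCharOnPos χ ∧ ∀ x : PGCA.pos, φ x = χ x := by
  -- Any linear extension will do; the character property is kept on the positive part only.
  obtain ⟨χ, hχ⟩ := LinearMap.exists_extend (p := PGCA.pos.toSubmodule) (φ : PGCA.pos →ₗ[ℂ] ℂ)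
  have h : ∀ x : PGCA.pos, φ x = χ x := fun x => (LinearMap.congr_fun hχ x).symm
  refine ⟨χ, fun x hx y hy => ?_, h⟩
  have h1 := LieAlgebra.lieCharacter_apply_lie φ ⟨x, hx⟩ ⟨y, hy⟩
  rwa [h] at h1

theorem isUpperPart_le {k : ℤ} (hk : k ≤ 1) : IsUpperPart (fun m => k ≤ m) :=
  ⟨fun h h' => h.trans h', hk⟩

theorem isUpperPart_true : IsUpperPart (fun _ => True) := ⟨fun _ _ => trivial, trivial⟩

section Characters

variable {χ : PGCA →ₗ[ℂ] ℂ}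

theorem PGCA.IsCharOnPos.apply_I (hχ : PGCA.IsCharOnPos χ) (h : χ (PGCA.I 1) = 0) {m : ℤ}
    (hm : 1 ≤ m) : χ (PGCA.I m) = 0 := by
  obtain rfl | h1 := hm.eq_or_lt
  · exact h
  · exact hχ.eq_zero.2.2.1 (by omega)

theorem PGCA.IsCharOnPos.apply_J (hχ : PGCA.IsCharOnPos χ) (h : χ (PGCA.J 1) = 0) {m : ℤ}
    (hm : 1 ≤ m) : χ (PGCA.J m) = 0 := by
  obtain rfl | h1 := hm.eq_or_lt
  · exact h
  · exact hχ.eq_zero.2.2.2 (by omega)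

/-- Only `I_0` is added, with value 1. The new brackets have indices at least 1, and [H_1, I_0] =
I_1 is where φ(I_1) = 0 enters. `H_0` must stay out (p = 1), as [H_0, I_0] = I_0 would force the
value 0. -/
theorem isUpperChar_I_zero (hχ : PGCA.IsCharOnPos χ) (h : χ (PGCA.I 1) = 0) :
    IsUpperChar χ 1 (fun m => 0 ≤ m) (fun m => 1 ≤ m) 1 0 where
  char := hχ
  nonneg := zero_le_one
  le_one := le_rfl
  upperI := isUpperPart_le zero_le_one
  upperJ := isUpperPart_le le_rfl
  valueI m n hm hn := by rw [if_neg (by omega), hχ.apply_I h (by omega)]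
  valueJ m n hm hn := by rw [if_neg (by omega), hχ.eq_zero.2.2.2 (by omega)]

theorem isUpperChar_J_zero (hχ : PGCA.IsCharOnPos χ) (h : χ (PGCA.J 1) = 0) :
    IsUpperChar χ 1 (fun m => 1 ≤ m) (fun m => 0 ≤ m) 0 1 where
  char := hχ
  nonneg := zero_le_one
  le_one := le_rfl
  upperI := isUpperPart_le le_rfl
  upperJ := isUpperPart_le zero_le_one
  valueI m n hm hn := by rw [if_neg (by omega), hχ.eq_zero.2.2.1 (by omega)]
  valueJ m n hm hn := by rw [if_neg (by omega), hχ.apply_J h (by omega)]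

theorem value_I_eq_zero (hχ : PGCA.IsCharOnPos χ) (h : χ (PGCA.I 1) = 0) (m : ℤ) :
    (if m ≤ 0 then 0 else χ (PGCA.I m)) = 0 := by
  split_ifs
  · rfl
  · exact hχ.apply_I h (by omega)

theorem value_J_eq_zero (hχ : PGCA.IsCharOnPos χ) (h : χ (PGCA.J 1) = 0) (m : ℤ) :
    (if m ≤ 0 then 0 else χ (PGCA.J m)) = 0 := by
  split_ifs
  · rfl
  · exact hχ.apply_J h (by omega)

/-- With p = 1, brackets inside 𝔭 reach `J_m` only for m ≥ 2, so χ(J_1) stays unconstrained. -/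
theorem isUpperChar_all_I (hχ : PGCA.IsCharOnPos χ) (h : χ (PGCA.I 1) = 0) :
    IsUpperChar χ 1 (fun _ => True) (fun m => 1 ≤ m) 0 0 where
  char := hχ
  nonneg := zero_le_one
  le_one := le_rfl
  upperI := isUpperPart_true
  upperJ := isUpperPart_le le_rfl
  valueI _ _ _ _ := value_I_eq_zero hχ h _
  valueJ m n hm hn := by rw [if_neg (by omega), hχ.eq_zero.2.2.2 (by omega)]

theorem isUpperChar_all_J (hχ : PGCA.IsCharOnPos χ) (h : χ (PGCA.J 1) = 0) :
    IsUpperChar χ 1 (fun m => 1 ≤ m) (fun _ => True) 0 0 where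
  char := hχ
  nonneg := zero_le_one
  le_one := le_rfl
  upperI := isUpperPart_le le_rfl
  upperJ := isUpperPart_true
  valueI m n hm hn := by rw [if_neg (by omega), hχ.eq_zero.2.2.1 (by omega)]
  valueJ _ _ _ _ := value_J_eq_zero hχ h _

/-- Taking p = 0 admits `H_0`, and [H_0, I_1] = I_1, [H_0, J_1] = -J_1 require both values to
vanish. -/
theorem isUpperChar_all (hχ : PGCA.IsCharOnPos χ) (hI : χ (PGCA.I 1) = 0)
    (hJ : χ (PGCA.J 1) = 0) : IsUpperChar χ 0 (fun _ => True) (fun _ => True) 0 0 where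
  char := hχ
  nonneg := le_rfl
  le_one := zero_le_one
  upperI := isUpperPart_true
  upperJ := isUpperPart_true
  valueI _ _ _ _ := value_I_eq_zero hχ hI _
  valueJ _ _ _ _ := value_J_eq_zero hχ hJ _

end Characters

/-! ### Nonzero proper submodules -/

theorem I_one_apply {φ : LieAlgebra.LieCharacter ℂ PGCA.pos} {χ : PGCA →ₗ[ℂ] ℂ}
    (hφ : ∀ x : PGCA.pos, φ x = χ x) (h : φ PGCA.posI = 0) : χ (PGCA.I 1) = 0 :=
  (hφ PGCA.posI).symm.trans h

theorem J_one_apply {φ : LieAlgebra.LieCharacter ℂ PGCA.pos} {χ : PGCA →ₗ[ℂ] ℂ}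
    (hφ : ∀ x : PGCA.pos, φ x = χ x) (h : φ PGCA.posJ = 0) : χ (PGCA.J 1) = 0 :=
  (hφ PGCA.posJ).symm.trans h

namespace PGCA

variable {φ : LieAlgebra.LieCharacter ℂ PGCA.pos}

/-- In the quotient where `I_0` takes the value 1, it fixes the image of the cyclic vector. Any
ideal containing `I_0` is allowed, so the lemma covers both ℐ and ℐ ⊕ 𝒥. -/
theorem idealAction_ne_bot_of_I (h : φ PGCA.posI = 0) {𝔞 : LieIdeal ℂ PGCA}
    (h𝔞 : I 0 ∈ 𝔞) : idealAction 𝔞 (GenericWhittaker φ) ≠ ⊥ := by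
  obtain ⟨χ, hχ, hφ⟩ := exists_functional φ
  have hu := isUpperChar_I_zero hχ (I_one_apply hφ h)
  obtain ⟨T, v, hv⟩ := exists_map_leftIdeal hu hφ 0
  refine idealAction_ne_bot (one_notMem_leftIdeal hu 0) T hv h𝔞 ?_
  have h1 := ι_sub_mem_leftIdeal (χ := χ) (p := 1) (Q := fun m => 0 ≤ m) (R := fun m => 1 ≤ m)
    (c := 0) (i := 1) (j := 0) (g := .I 0) le_rfl
  simpa [value] using h1

theorem idealAction_ne_bot_of_J (h : φ PGCA.posJ = 0) {𝔞 : LieIdeal ℂ PGCA}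
    (h𝔞 : J 0 ∈ 𝔞) : idealAction 𝔞 (GenericWhittaker φ) ≠ ⊥ := by
  obtain ⟨χ, hχ, hφ⟩ := exists_functional φ
  have hu := isUpperChar_J_zero hχ (J_one_apply hφ h)
  obtain ⟨T, v, hv⟩ := exists_map_leftIdeal hu hφ 0
  refine idealAction_ne_bot (one_notMem_leftIdeal hu 0) T hv h𝔞 ?_
  have h1 := ι_sub_mem_leftIdeal (χ := χ) (p := 1) (Q := fun m => 1 ≤ m) (R := fun m => 0 ≤ m)
    (c := 0) (i := 0) (j := 1) (g := .J 0) le_rfl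
  simpa [value] using h1

theorem I_mem_idealI (m : ℤ) : I m ∈ idealI := Submodule.subset_span ⟨m, rfl⟩

theorem J_mem_idealJ (m : ℤ) : J m ∈ idealJ := Submodule.subset_span ⟨m, rfl⟩

theorem Gamma_ne_top (h : φ PGCA.posI = 0) : Gamma φ ≠ ⊤ := by
  obtain ⟨χ, hχ, hφ⟩ := exists_functional φ
  have hI := I_one_apply hφ h
  have hu := isUpperChar_all_I hχ hI
  obtain ⟨T, v, hv⟩ := exists_map_leftIdeal hu hφ 0
  exact ne_top_of_le_ker (one_notMem_leftIdeal hu 0) T hv (idealAction_le_ker _ T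
    fun x hx u => ι_mul_mem_leftIdeal_I (fun _ => trivial) (value_I_eq_zero hχ hI) hx u)

theorem Upsilon_ne_top (h : φ PGCA.posJ = 0) : Upsilon φ ≠ ⊤ := by
  obtain ⟨χ, hχ, hφ⟩ := exists_functional φ
  have hJ := J_one_apply hφ h
  have hu := isUpperChar_all_J hχ hJ
  obtain ⟨T, v, hv⟩ := exists_map_leftIdeal hu hφ 0
  exact ne_top_of_le_ker (one_notMem_leftIdeal hu 0) T hv (idealAction_le_ker _ T
    fun x hx u => ι_mul_mem_leftIdeal_J (fun _ => trivial) (value_J_eq_zero hχ hJ) hx u)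

theorem Omega_ne_top (hI : φ PGCA.posI = 0) (hJ : φ PGCA.posJ = 0) : Omega φ ≠ ⊤ := by
  obtain ⟨χ, hχ, hφ⟩ := exists_functional φ
  have hI := I_one_apply hφ hI
  have hJ := J_one_apply hφ hJ
  have hu := isUpperChar_all hχ hI hJ
  obtain ⟨T, v, hv⟩ := exists_map_leftIdeal hu hφ 0
  refine ne_top_of_le_ker (one_notMem_leftIdeal hu 0) T hv (idealAction_le_ker _ T
    fun x hx u => ?_)
  obtain ⟨y, hy, z, hz, rfl⟩ := LieSubmodule.mem_sup _ _ _ |>.mp hx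
  rw [UEA.ι, map_add, add_mul]
  exact Submodule.add_mem _
    (ι_mul_mem_leftIdeal_I (fun _ => trivial) (value_I_eq_zero hχ hI) hy u)
    (ι_mul_mem_leftIdeal_J (fun _ => trivial) (value_J_eq_zero hχ hJ) hz u)

end PGCA

namespace PGCAExt

variable {φ : LieAlgebra.LieCharacter ℂ PGCA.pos}

theorem idealAction_ne_bot_of_I (h : φ PGCA.posI = 0) (ξ : Fin 3 → ℂ) {𝔞 : LieIdeal ℂ PGCAExt}
    (h𝔞 : I 0 ∈ 𝔞) : idealAction 𝔞 (GenericWhittaker φ ξ) ≠ ⊥ := by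
  obtain ⟨χ, hχ, hφ⟩ := exists_functional φ
  have hu := isUpperChar_I_zero hχ (I_one_apply hφ h)
  obtain ⟨T, v, hv⟩ := exists_map_leftIdeal hu hφ ξ 0
  refine idealAction_ne_bot (one_notMem_leftIdeal hu ξ 0) T hv h𝔞 ?_
  have h1 := ι_sub_mem_leftIdeal (χ := χ) (p := 1) (Q := fun m => 0 ≤ m) (R := fun m => 1 ≤ m)
    (ξ := ξ)
    (c := 0) (i := 1) (j := 0) (g := .I 0) le_rfl
  simpa [value] using h1

theorem idealAction_ne_bot_of_J (h : φ PGCA.posJ = 0) (ξ : Fin 3 → ℂ) {𝔞 : LieIdeal ℂ PGCAExt}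
    (h𝔞 : J 0 ∈ 𝔞) : idealAction 𝔞 (GenericWhittaker φ ξ) ≠ ⊥ := by
  obtain ⟨χ, hχ, hφ⟩ := exists_functional φ
  have hu := isUpperChar_J_zero hχ (J_one_apply hφ h)
  obtain ⟨T, v, hv⟩ := exists_map_leftIdeal hu hφ ξ 0
  refine idealAction_ne_bot (one_notMem_leftIdeal hu ξ 0) T hv h𝔞 ?_
  have h1 := ι_sub_mem_leftIdeal (χ := χ) (p := 1) (Q := fun m => 1 ≤ m) (R := fun m => 0 ≤ m)
    (ξ := ξ)
    (c := 0) (i := 0) (j := 1) (g := .J 0) le_rfl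
  simpa [value] using h1

theorem I_mem_idealI (m : ℤ) : I m ∈ idealI := Submodule.subset_span ⟨m, rfl⟩

theorem J_mem_idealJ (m : ℤ) : J m ∈ idealJ := Submodule.subset_span ⟨m, rfl⟩

theorem GammaTilde_ne_top (h : φ PGCA.posI = 0) (ξ : Fin 3 → ℂ) : GammaTilde φ ξ ≠ ⊤ := by
  obtain ⟨χ, hχ, hφ⟩ := exists_functional φ
  have hI := I_one_apply hφ h
  have hu := isUpperChar_all_I hχ hI
  obtain ⟨T, v, hv⟩ := exists_map_leftIdeal hu hφ ξ 0
  exact ne_top_of_le_ker (one_notMem_leftIdeal hu ξ 0) T hv (idealAction_le_ker _ T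
    fun x hx u => ι_mul_mem_leftIdeal_I (fun _ => trivial) (value_I_eq_zero hχ hI) hx u)

theorem UpsilonTilde_ne_top (h : φ PGCA.posJ = 0) (ξ : Fin 3 → ℂ) : UpsilonTilde φ ξ ≠ ⊤ := by
  obtain ⟨χ, hχ, hφ⟩ := exists_functional φ
  have hJ := J_one_apply hφ h
  have hu := isUpperChar_all_J hχ hJ
  obtain ⟨T, v, hv⟩ := exists_map_leftIdeal hu hφ ξ 0
  exact ne_top_of_le_ker (one_notMem_leftIdeal hu ξ 0) T hv (idealAction_le_ker _ T
    fun x hx u => ι_mul_mem_leftIdeal_J (fun _ => trivial) (value_J_eq_zero hχ hJ) hx u)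

theorem OmegaTildeSubmodule_ne_bot (h : φ PGCA.posI = 0) (ξ : Fin 3 → ℂ) (c : ℂ) :
    OmegaTildeSubmodule φ ξ c ≠ ⊥ := by
  have h1 := idealAction_ne_bot_of_I h ξ
    ((le_sup_left : idealI ≤ idealI ⊔ idealJ) (I_mem_idealI 0))
  have h2 : idealAction (idealI ⊔ idealJ) (GenericWhittaker φ ξ) ≤ OmegaTildeSubmodule φ ξ c :=
    fun v hv => show v ∈ OmegaTilde φ ξ c from Submodule.mem_sup_left hv
  exact ne_bot_of_le_ne_bot h1 h2

theorem OmegaTildeSubmodule_ne_top (hI : φ PGCA.posI = 0) (hJ : φ PGCA.posJ = 0)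
    (ξ : Fin 3 → ℂ) (c : ℂ) : OmegaTildeSubmodule φ ξ c ≠ ⊤ := by
  obtain ⟨χ, hχ, hφ⟩ := exists_functional φ
  have hI := I_one_apply hφ hI
  have hJ := J_one_apply hφ hJ
  have hu := isUpperChar_all hχ hI hJ
  obtain ⟨T, v, hv⟩ := exists_map_leftIdeal hu hφ ξ c
  exact ne_top_of_le_ker (one_notMem_leftIdeal hu ξ c) T hv
    (OmegaTildeSubmodule_le_ker le_rfl (fun _ => trivial) (fun _ => trivial)
      (value_I_eq_zero hχ hI) (value_J_eq_zero hχ hJ) T)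

end PGCAExt

end

theorem mainTheorem7 (φ : LieAlgebra.LieCharacter ℂ PGCA.pos) (hφ : PGCA.IsSingular φ)
    (ξ : Fin 3 → ℂ) :
    IsReducibleModule (UEA PGCA) (PGCA.GenericWhittaker φ) ∧
    IsReducibleModule (UEA PGCAExt) (PGCAExt.GenericWhittaker φ ξ) ∧
    (φ PGCA.posI = 0 → φ PGCA.posJ = 0 →
      (PGCA.Omega φ ≠ ⊥ ∧ PGCA.Omega φ ≠ ⊤) ∧
      ∀ c : ℂ, ∃ N : Submodule (UEA PGCAExt) (PGCAExt.GenericWhittaker φ ξ),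
        N.restrictScalars ℂ = PGCAExt.OmegaTilde φ ξ c ∧ N ≠ ⊥ ∧ N ≠ ⊤) ∧
    (φ PGCA.posI = 0 → φ PGCA.posJ ≠ 0 →
      (PGCA.Gamma φ ≠ ⊥ ∧ PGCA.Gamma φ ≠ ⊤) ∧
      (PGCAExt.GammaTilde φ ξ ≠ ⊥ ∧ PGCAExt.GammaTilde φ ξ ≠ ⊤)) ∧
    (φ PGCA.posI ≠ 0 → φ PGCA.posJ = 0 →
      (PGCA.Upsilon φ ≠ ⊥ ∧ PGCA.Upsilon φ ≠ ⊤) ∧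
      (PGCAExt.UpsilonTilde φ ξ ≠ ⊥ ∧ PGCAExt.UpsilonTilde φ ξ ≠ ⊤)) := by
  have h1 : φ PGCA.posI = 0 → φ PGCA.posJ = 0 →
      (PGCA.Omega φ ≠ ⊥ ∧ PGCA.Omega φ ≠ ⊤) ∧
      ∀ c : ℂ, ∃ N : Submodule (UEA PGCAExt) (PGCAExt.GenericWhittaker φ ξ),
        N.restrictScalars ℂ = PGCAExt.OmegaTilde φ ξ c ∧ N ≠ ⊥ ∧ N ≠ ⊤ := fun hI hJ =>
    ⟨⟨PGCA.idealAction_ne_bot_of_I hI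
        ((le_sup_left : PGCA.idealI ≤ PGCA.idealI ⊔ PGCA.idealJ) (PGCA.I_mem_idealI 0)),
      PGCA.Omega_ne_top hI hJ⟩,
    fun c => ⟨PGCAExt.OmegaTildeSubmodule φ ξ c, rfl,
      PGCAExt.OmegaTildeSubmodule_ne_bot hI ξ c, PGCAExt.OmegaTildeSubmodule_ne_top hI hJ ξ c⟩⟩
  have h2 : φ PGCA.posI = 0 →
      (PGCA.Gamma φ ≠ ⊥ ∧ PGCA.Gamma φ ≠ ⊤) ∧
      (PGCAExt.GammaTilde φ ξ ≠ ⊥ ∧ PGCAExt.GammaTilde φ ξ ≠ ⊤) := fun hI =>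
    ⟨⟨PGCA.idealAction_ne_bot_of_I hI (PGCA.I_mem_idealI 0), PGCA.Gamma_ne_top hI⟩,
      PGCAExt.idealAction_ne_bot_of_I hI ξ (PGCAExt.I_mem_idealI 0),
      PGCAExt.GammaTilde_ne_top hI ξ⟩
  have h3 : φ PGCA.posJ = 0 →
      (PGCA.Upsilon φ ≠ ⊥ ∧ PGCA.Upsilon φ ≠ ⊤) ∧
      (PGCAExt.UpsilonTilde φ ξ ≠ ⊥ ∧ PGCAExt.UpsilonTilde φ ξ ≠ ⊤) := fun hJ =>
    ⟨⟨PGCA.idealAction_ne_bot_of_J hJ (PGCA.J_mem_idealJ 0), PGCA.Upsilon_ne_top hJ⟩,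
      PGCAExt.idealAction_ne_bot_of_J hJ ξ (PGCAExt.J_mem_idealJ 0),
      PGCAExt.UpsilonTilde_ne_top hJ ξ⟩
  -- A vanishing product gives φ(I_1) = 0 or φ(J_1) = 0, so the submodule generated by ℐ or by 𝒥
  -- already witnesses reducibility.
  refine ⟨?_, ?_, h1, fun hI _ => h2 hI, fun _ hJ => h3 hJ⟩
  · rcases mul_eq_zero.mp hφ with h | h
    · exact ⟨_, (h2 h).1⟩
    · exact ⟨_, (h3 h).1⟩
  · rcases mul_eq_zero.mp hφ with h | h
    · exact ⟨_, (h2 h).2⟩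
    · exact ⟨_, (h3 h).2⟩
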